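/- **Setting.** A principal contracts with one agent who has $n$ actions $a_1,\dots,a_n$, each of which can be taken safely ($s=1$) or unsafely ($s=0$). Action $a_i$ costs the agent $c_i\ge 0$, and complying with the safety measures costs an additional $\kappa_S\ge 0$. A safe action $(a_i,1)$ yields a nonnegative random reward with finite mean $R_i$. An unsafe action $(a_i,0)$ yields the reward $-\infty$ with probability $\alpha\in(0,1]$, and otherwise a reward distributed as for $(a_i,1)$. A linear contract is a pair $(\gamma,\beta)\in[0,1]^2$: the principal inspects with probability $\beta$, at cost $\kappa_I\ge 0$, independently of the side effects, and pays $\gamma r$ when the reward is $r$, but pays nothing if the reward is $-\infty$ or if an inspection reveals that the agent was unsafe. The agent's expected utilities are therefore $$\mathcal U_a(a_i,1)=\gamma R_i-c_i-\kappa_S,\qquad \mathcal U_a(a_i,0)=(1-\beta)(1-\alpha)\gamma R_i-c_i,$$ and the principal's are $\mathcal U_p(a_i,1)=(1-\gamma)R_i-\beta\kappa_I$ and $\mathcal U_p(a_i,0)=-\infty$. The contract $(\gamma,\beta)$ implements $(a_i,s)$ if $\mathcal U_a(a_i,s)\ge 0$ and $\mathcal U_a(a_i,s)\ge\mathcal U_a(a_{i'},s')$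 for all $i',s'$. It is an optimal linear contract if it implements an action whose value of $\mathcal U_p$ is the largest among all actions implemented by linear contracts. **Theorem.** Suppose that (1) different actions have different costs, and an action with a higher cost also has a higher expected reward, i.e. $c_i<c_j$ implies $R_i<R_j$; and (2) $\max_i(R_i-c_i)>\kappa_S$. Then an optimal linear contract $(\gamma^*,\beta^*)$ can be computed in time $\mathcal O(n\log n)$. That is, there are a single program of a real RAM (exact real arithmetic $+,-,\times,/,\sqrt{\cdot}$ and comparisons, natural-number arithmetic for addressing, unit cost per operation) and a function $T$ with $T(n)=\mathcal O(n\log n)$ as $n\to\infty$ such that, for every $n$ and all data satisfying (1) and (2), the program, given $n$, $(R_i,c_i)_{i=1}^n$ (in any order), $\kappa_S$, $\kappa_I$ and $\alpha$, halts after at most $T(n)$ steps and outputs an optimal linear contract $(\gamma^*,\beta^*)$. -/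

import Mathlib

open MeasureTheory Filter Asymptotics

/-! ### The real RAM

Programs of a real random-access machine: structured programs over natural-number cells (used for
counting and addressing) and real cells (used for exact arithmetic). Every arithmetic operation,
memory access, comparison and control step costs one unit of time. There is no conversion between
real numbers and natural numbers. -/

namespace RealRAM

/-- The memory: natural-number arrays and real arrays, both named by natural numbers. A program is
a finite text, so it names only finitely many arrays. -/
structure Store where
  nat : ℕ → ℕ → ℕ
  real : ℕ → ℕ → ℝ

namespace Store

/-- Overwrite cell `i` of the natural-number array `a`. -/
def setNat (σ : Store) (a i v : ℕ) : Store :=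
  { σ with nat := Function.update σ.nat a (Function.update (σ.nat a) i v) }

/-- Overwrite cell `i` of the real array `a`. -/
noncomputable def setReal (σ : Store) (a i : ℕ) (v : ℝ) : Store :=
  { σ with real := Function.update σ.real a (Function.update (σ.real a) i v) }

end Store

/-- Natural-number expressions: literals, cells of arrays (with computed index), addition,
truncated subtraction, and halving with rounding down. -/
inductive NatExpr where
  | lit (k : ℕ)
  | cell (a : ℕ) (i : NatExpr)
  | add (e f : NatExpr)
  | sub (e f : NatExpr)
  | half (e : NatExpr)

namespace NatExpr

def eval (σ : Store) : NatExpr → ℕ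
  | lit k => k
  | cell a i => σ.nat a (i.eval σ)
  | add e f => e.eval σ + f.eval σ
  | sub e f => e.eval σ - f.eval σ
  | half e => e.eval σ / 2

/-- The number of unit-time operations in the evaluation. -/
def cost : NatExpr → ℕ
  | lit _ => 1
  | cell _ i => i.cost + 1
  | add e f => e.cost + f.cost + 1
  | sub e f => e.cost + f.cost + 1
  | half e => e.cost + 1

end NatExpr

/-- Real expressions: whole-number literals, cells of arrays (with computed index), the four
arithmetic operations and the square root. Division by zero and the square root of a negative
number give `0`; a program can test for these cases by one comparison. -/
inductive RealExpr where
  | lit (k : ℕ)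
  | cell (a : ℕ) (i : NatExpr)
  | add (e f : RealExpr)
  | sub (e f : RealExpr)
  | mul (e f : RealExpr)
  | div (e f : RealExpr)
  | sqrt (e : RealExpr)

namespace RealExpr

noncomputable def eval (σ : Store) : RealExpr → ℝ
  | lit k => (k : ℝ)
  | cell a i => σ.real a (i.eval σ)
  | add e f => e.eval σ + f.eval σ
  | sub e f => e.eval σ - f.eval σ
  | mul e f => e.eval σ * f.eval σ
  | div e f => e.eval σ / f.eval σ
  | sqrt e => Real.sqrt (e.eval σ)

/-- The number of unit-time operations in the evaluation. -/
def cost : RealExpr → ℕ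
  | lit _ => 1
  | cell _ i => i.cost + 1
  | add e f => e.cost + f.cost + 1
  | sub e f => e.cost + f.cost + 1
  | mul e f => e.cost + f.cost + 1
  | div e f => e.cost + f.cost + 1
  | sqrt e => e.cost + 1

end RealExpr

/-- Tests: comparisons and their Boolean combinations. -/
inductive Test where
  | natLe (e f : NatExpr)
  | realLe (e f : RealExpr)
  | neg (b : Test)
  | conj (b d : Test)

namespace Test

def Holds (σ : Store) : Test → Prop
  | natLe e f => e.eval σ ≤ f.eval σ
  | realLe e f => e.eval σ ≤ f.eval σ
  | neg b => ¬ b.Holds σ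
  | conj b d => b.Holds σ ∧ d.Holds σ

/-- The number of unit-time operations in the evaluation. -/
def cost : Test → ℕ
  | natLe e f => e.cost + f.cost + 1
  | realLe e f => e.cost + f.cost + 1
  | neg b => b.cost + 1
  | conj b d => b.cost + d.cost + 1

end Test

/-- Programs. `setNat a i e` and `setReal a i e` store the value of `e` in cell `i` of array `a`;
`branch b p q` is "if `b` then `p` else `q`"; `loop b p` is "while `b` do `p`". -/
inductive Program where
  | skip
  | setNat (a : ℕ) (i e : NatExpr)
  | setReal (a : ℕ) (i : NatExpr) (e : RealExpr)
  | seq (p q : Program)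
  | branch (b : Test) (p q : Program)
  | loop (b : Test) (p : Program)

/-- `Runs p σ σ' t`: started with memory `σ`, the program `p` halts with memory `σ'` after exactly
`t` units of time. -/
inductive Runs : Program → Store → Store → ℕ → Prop where
  | skip (σ : Store) : Runs Program.skip σ σ 1
  | setNat (σ : Store) (a : ℕ) (i e : NatExpr) :
      Runs (Program.setNat a i e) σ (σ.setNat a (i.eval σ) (e.eval σ)) (i.cost + e.cost + 1)
  | setReal (σ : Store) (a : ℕ) (i : NatExpr) (e : RealExpr) :
      Runs (Program.setReal a i e) σ (σ.setReal a (i.eval σ) (e.eval σ)) (i.cost + e.cost + 1)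
  | seq {p q : Program} {σ σ' σ'' : Store} {s t : ℕ} :
      Runs p σ σ' s → Runs q σ' σ'' t → Runs (Program.seq p q) σ σ'' (s + t + 1)
  | branch_true {b : Test} {p q : Program} {σ σ' : Store} {t : ℕ} :
      b.Holds σ → Runs p σ σ' t → Runs (Program.branch b p q) σ σ' (b.cost + t + 1)
  | branch_false {b : Test} {p q : Program} {σ σ' : Store} {t : ℕ} :
      ¬ b.Holds σ → Runs q σ σ' t → Runs (Program.branch b p q) σ σ' (b.cost + t + 1)
  | loop_done {b : Test} {p : Program} {σ : Store} :
      ¬ b.Holds σ → Runs (Program.loop b p) σ σ (b.cost + 1)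
  | loop_step {b : Test} {p : Program} {σ σ' σ'' : Store} {s t : ℕ} :
      b.Holds σ → Runs p σ σ' s → Runs (Program.loop b p) σ' σ'' t →
        Runs (Program.loop b p) σ σ'' (b.cost + s + t + 1)

end RealRAM

/-! ### Contracts with inspection, single agent -/

/-- The single-agent setting with `n` productive actions, each of which can be taken safely or
unsafely. -/
structure SafetyAgent (n : ℕ) where
  /-- the law `f(· | a i)` of the reward of action `i` when no side effect occurs -/
  rewardLaw : Fin n → Measure ℝ
  rewardLaw_prob : ∀ i, IsProbabilityMeasure (rewardLaw i)
  rewardLaw_nonneg : ∀ i, ∀ᵐ r ∂(rewardLaw i), 0 ≤ r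
  rewardLaw_integrable : ∀ i, Integrable (fun r : ℝ => r) (rewardLaw i)
  /-- the cost `c i` of action `i` -/
  cost : Fin n → ℝ
  cost_nonneg : ∀ i, 0 ≤ cost i
  /-- the agent's cost `κ_S` of complying with the safety measures -/
  safetyCost : ℝ
  safetyCost_nonneg : 0 ≤ safetyCost
  /-- the principal's cost `κ_I` of an inspection -/
  inspectionCost : ℝ
  inspectionCost_nonneg : 0 ≤ inspectionCost
  /-- the probability `α` of side effects (reward `-∞`) after an unsafe action -/
  sideEffectProb : ℝ
  sideEffectProb_pos : 0 < sideEffectProb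
  sideEffectProb_le_one : sideEffectProb ≤ 1

/-- A contract: the payment `t(r)` as a function of the realized (finite) reward `r`, and the
probability `β` of an inspection. Nothing is paid if side effects occur. -/
structure SafetyContract where
  payment : ℝ → ℝ
  inspection : ℝ

/-- The linear contract `(γ, β)`, with payment `t(r) = γ r`. -/
noncomputable def linearContract (γ β : ℝ) : SafetyContract where
  payment := fun r => γ * r
  inspection := β

namespace SafetyAgent

variable {n : ℕ}

/-- The expected reward `R i`. -/
noncomputable def expectedReward (A : SafetyAgent n) (i : Fin n) : ℝ :=
  ∫ r, r ∂(A.rewardLaw i)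

/-- The expected payment `T i` for the safe action `i`. -/
noncomputable def expectedPayment (A : SafetyAgent n) (C : SafetyContract) (i : Fin n) : ℝ :=
  ∫ r, C.payment r ∂(A.rewardLaw i)

/-- The agent's expected utility from action `(a i, s)`, where `s = true` means safe: an unsafe
agent is paid only if there is neither an inspection nor a side effect. -/
noncomputable def agentUtility (A : SafetyAgent n) (C : SafetyContract) (i : Fin n) : Bool → ℝ
  | true => A.expectedPayment C i - A.cost i - A.safetyCost
  | false => (1 - C.inspection) * (1 - A.sideEffectProb) * A.expectedPayment C i - A.cost i

/-- The principal's expected utility from action `(a i, s)`; it is `-∞` if the action is unsafe. -/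
noncomputable def principalUtility (A : SafetyAgent n) (C : SafetyContract) (i : Fin n) :
    Bool → EReal
  | true =>
      ((A.expectedReward i - A.expectedPayment C i - C.inspection * A.inspectionCost : ℝ) : EReal)
  | false => ⊥

/-- The contract `C` implements the action `(a i, s)`: incentive compatibility and individual
rationality hold. -/
def Implements (A : SafetyAgent n) (C : SafetyContract) (i : Fin n) (s : Bool) : Prop :=
  (∀ (i' : Fin n) (s' : Bool), A.agentUtility C i' s' ≤ A.agentUtility C i s) ∧
    0 ≤ A.agentUtility C i s

/-- The linear contract `(γ, β)` is optimal: it implements an action whose utility for the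
principal is the largest among all actions implemented by linear contracts. -/
def IsOptimalLinear (A : SafetyAgent n) (γ β : ℝ) : Prop :=
  γ ∈ Set.Icc (0 : ℝ) 1 ∧ β ∈ Set.Icc (0 : ℝ) 1 ∧
    ∃ (i : Fin n) (s : Bool), A.Implements (linearContract γ β) i s ∧
      ∀ γ' ∈ Set.Icc (0 : ℝ) 1, ∀ β' ∈ Set.Icc (0 : ℝ) 1, ∀ (i' : Fin n) (s' : Bool),
        A.Implements (linearContract γ' β') i' s' →
          A.principalUtility (linearContract γ' β') i' s' ≤
            A.principalUtility (linearContract γ β) i s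

/-- Different actions have different costs, and an action with a higher cost has a higher expected
reward. The actions need not be listed in increasing order. -/
def NoDominatedAction (A : SafetyAgent n) : Prop :=
  Function.Injective A.cost ∧
    ∀ i j, A.cost i < A.cost j → A.expectedReward i < A.expectedReward j

/-- `max_i (R i - c i) > κ_S` (in particular, there is an action). -/
def SafetyFeasible (A : SafetyAgent n) : Prop :=
  ∃ i, A.safetyCost < A.expectedReward i - A.cost i

/-- The input: `n` in natural-number array `0`; the expected rewards in real array `0`, the costs
in real array `1`, and `κ_S`, `κ_I`, `α` in real array `2`. All other cells are zero. -/
noncomputable def inputStore (A : SafetyAgent n) : RealRAM.Store where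
  nat := fun a i => if a = 0 ∧ i = 0 then n else 0
  real := fun a i =>
    match a with
    | 0 => if h : i < n then A.expectedReward ⟨i, h⟩ else 0
    | 1 => if h : i < n then A.cost ⟨i, h⟩ else 0
    | 2 =>
      match i with
      | 0 => A.safetyCost
      | 1 => A.inspectionCost
      | 2 => A.sideEffectProb
      | _ => 0
    | _ => 0

end SafetyAgent

/-!
Only safe actions are worth implementing, and the agent's choice is read off from lines. Let
`U x` be the maximum of `0` and all `R i * x - c i`. The contract implements the safe action `i` iff
line `i` attains the maximum of the lines at `γ` and
`U ((1 - β) * (1 - α) * γ) ≤ R i * γ - c i - κ_S`: putting the zero line into `U` makes individual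
rationality part of this condition. So only the lines on the upper envelope matter
(`HasEnvelope.exists_envelopeContract`). Actions without reward can be left out, since they are
implemented only if `κ_S = 0` and never give the principal more than `0`.

If line `i` is the highest one at `γ`, and line `j` is the highest one at the point `x` where `U x`
equals `R i * γ - c i - κ_S`, then the least deterring `β` is an explicit function of `γ`
(`leastInspection`). The cost `γ * R i + β * κ_I` to the principal first decreases and then
increases in `γ`, with a turning point given by a quotient or a square root, so that the best `γ` in
an interval is explicit (`cheapestShare_spec`). When `γ` grows, so do `i` and `j`. Hence two pointers
that move only forwards meet all relevant pairs, which are linearly many, and the best of their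
contracts is optimal (`Envelope.covered_left`, `Envelope.covered_right`, `HasEnvelope.isOptimalLinear`).

Sorting is done by a tournament tree whose root is extracted `n` times. Each extraction repairs the
path from one leaf to the root, in `O(log n)` steps (`halts_replay`). The envelope of the sorted
lines is computed with a stack in linear time (`halts_buildEnvelope`), and the sweep is linear as well
(`halts_sweep`).

Running times are counted in multiples of the size of the program text (`Halts`). Loop-free code is
verified by computing weakest preconditions (`Program.wp`), loops by an invariant and a variant
(`Halts.loop`).
-/

/-! ### Reasoning about real RAM programs -/

namespace RealRAM

@[simp] theorem Store.nat_setNat (σ : Store) (a i v b : ℕ) :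
    (σ.setNat a i v).nat b = if b = a then Function.update (σ.nat a) i v else σ.nat b := by
  simp [Store.setNat, Function.update_apply]

@[simp] theorem Store.real_setNat (σ : Store) (a i v : ℕ) : (σ.setNat a i v).real = σ.real := rfl

@[simp] theorem Store.nat_setReal (σ : Store) (a i : ℕ) (v : ℝ) :
    (σ.setReal a i v).nat = σ.nat := rfl

@[simp] theorem Store.real_setReal (σ : Store) (a i : ℕ) (v : ℝ) (b : ℕ) :
    (σ.setReal a i v).real b =
      if b = a then Function.update (σ.real a) i v else σ.real b := by
  simp [Store.setReal, Function.update_apply]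

namespace Program

/-- The weakest precondition of a program without loops. -/
def wp : Program → (Store → Prop) → Store → Prop
  | skip, Q, σ => Q σ
  | setNat a i e, Q, σ => Q (σ.setNat a (i.eval σ) (e.eval σ))
  | setReal a i e, Q, σ => Q (σ.setReal a (i.eval σ) (e.eval σ))
  | seq p q, Q, σ => p.wp (q.wp Q) σ
  | branch b p q, Q, σ => (b.Holds σ → p.wp Q σ) ∧ (¬ b.Holds σ → q.wp Q σ)
  | loop _ _, _, _ => False

/-- The size of a program, which bounds its running time if it has no loops. Running times are
stated as multiples of this number. -/
def size : Program → ℕ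
  | skip => 1
  | setNat _ i e => i.cost + e.cost + 1
  | setReal _ i e => i.cost + e.cost + 1
  | seq p q => p.size + q.size + 1
  | branch b p q => b.cost + (p.size + q.size) + 1
  | loop b p => b.cost + p.size + 1

end Program

/-- Started with memory `σ`, the program `p` halts within `p.size * W` units of time with a memory
that satisfies `Q`. Measuring time in multiples of the program size keeps the constant factors out
of the proofs: only the numbers of rounds of the loops enter the workload `W`. -/
def Halts (p : Program) (σ : Store) (W : ℕ) (Q : Store → Prop) : Prop :=
  ∃ (σ' : Store) (t : ℕ), Runs p σ σ' t ∧ t ≤ p.size * W ∧ Q σ'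

theorem Halts.mono {p : Program} {σ : Store} {W W' : ℕ} {Q Q' : Store → Prop}
    (h : Halts p σ W Q) (hW : W ≤ W') (hQ : ∀ σ', Q σ' → Q' σ') : Halts p σ W' Q' := by
  obtain ⟨σ', t, hr, ht, hq⟩ := h
  exact ⟨σ', t, hr, ht.trans (Nat.mul_le_mul_left _ hW), hQ _ hq⟩

theorem Halts.seq {p q : Program} {σ : Store} {W : ℕ} {M Q : Store → Prop} (hW : 0 < W)
    (hp : Halts p σ W M) (hq : ∀ σ', M σ' → Halts q σ' W Q) :
    Halts (.seq p q) σ W Q := by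
  obtain ⟨σ', s, hr, hs, hm⟩ := hp
  obtain ⟨σ'', t, hr', ht, hQ⟩ := hq σ' hm
  refine ⟨σ'', _, .seq hr hr', ?_, hQ⟩
  simp only [Program.size, add_mul, one_mul]
  omega

theorem halts_of_wp_one (p : Program) {Q : Store → Prop} {σ : Store} (h : p.wp Q σ) :
    Halts p σ 1 Q := by
  induction p generalizing Q σ with
  | skip => exact ⟨_, _, .skip σ, le_rfl, h⟩
  | setNat a i e => exact ⟨_, _, .setNat σ a i e, by simp [Program.size], h⟩
  | setReal a i e => exact ⟨_, _, .setReal σ a i e, by simp [Program.size], h⟩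
  | seq p q ihp ihq => exact (ihp h).seq one_pos fun σ' h' => ihq h'
  | branch b p q ihp ihq =>
    by_cases hb : b.Holds σ
    · obtain ⟨σ', t, hr, ht, hQ⟩ := ihp (h.1 hb)
      exact ⟨σ', _, .branch_true hb hr, by simp only [Program.size]; omega, hQ⟩
    · obtain ⟨σ', t, hr, ht, hQ⟩ := ihq (h.2 hb)
      exact ⟨σ', _, .branch_false hb hr, by simp only [Program.size]; omega, hQ⟩
  | loop b p => exact h.elim

theorem halts_of_wp {p : Program} {Q : Store → Prop} {σ : Store} {W : ℕ} (hW : 0 < W)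
    (h : p.wp Q σ) : Halts p σ W Q :=
  (halts_of_wp_one p h).mono hW fun _ h' => h'

theorem Halts.seq_wp {p q : Program} {σ : Store} {W : ℕ} {Q : Store → Prop} (hW : 0 < W)
    (h : p.wp (fun σ' => Halts q σ' W Q) σ) : Halts (.seq p q) σ W Q :=
  (halts_of_wp hW h).seq hW fun _ h' => h'

/-- Total correctness of a loop with invariant `I`, whose variant `μ` decreases in every round;
a round has workload at most `V`, and there are at most `N` rounds. -/
theorem Halts.loop {b : Test} {p : Program} (I : Store → Prop) (μ : Store → ℕ) {V N : ℕ}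
    (hV : 0 < V) (step : ∀ σ, I σ → b.Holds σ → Halts p σ V (fun σ' => I σ' ∧ μ σ' < μ σ))
    {σ : Store} (h : I σ) (hN : μ σ ≤ N) :
    Halts (.loop b p) σ (V * (N + 1)) (fun σ' => I σ' ∧ ¬ b.Holds σ') := by
  simp only [Halts, Program.size]
  induction N generalizing σ with
  | zero =>
    by_cases hb : b.Holds σ
    · obtain ⟨σ', s, hr, hs, hI, hμ⟩ := step σ h hb
      omega
    · refine ⟨σ, _, .loop_done hb, ?_, h, hb⟩
      nlinarith
  | succ N ih =>
    by_cases hb : b.Holds σ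
    · obtain ⟨σ', s, hr, hs, hI, hμ⟩ := step σ h hb
      obtain ⟨σ'', t, hr', ht, hQ⟩ := ih hI (by omega)
      refine ⟨σ'', _, .loop_step hb hr hr', ?_, hQ⟩
      have : b.cost + 1 ≤ (b.cost + 1) * V := Nat.le_mul_of_pos_right _ hV
      linarith
    · refine ⟨σ, _, .loop_done hb, ?_, h, hb⟩
      have : b.cost + 1 ≤ (b.cost + 1) * (V * (N + 1 + 1)) :=
        Nat.le_mul_of_pos_right _ (by positivity)
      linarith [Nat.zero_le (p.size * (V * (N + 1 + 1)))]

/-- `Halts.loop` for a loop whose body contains no further loop. -/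
theorem Halts.loop_wp {b : Test} {p : Program} (I : Store → Prop) (μ : Store → ℕ) {N : ℕ}
    (step : ∀ σ, I σ → b.Holds σ → p.wp (fun σ' => I σ' ∧ μ σ' < μ σ) σ)
    {σ : Store} (h : I σ) (hN : μ σ ≤ N) :
    Halts (.loop b p) σ (N + 1) (fun σ' => I σ' ∧ ¬ b.Holds σ') := by
  have := Halts.loop I μ one_pos (fun σ h1 h2 => halts_of_wp one_pos (step σ h1 h2)) h hN
  rwa [one_mul] at this

namespace Program

theorem wp_mono {p : Program} {Q Q' : Store → Prop} (hQ : ∀ σ, Q σ → Q' σ) :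
    ∀ {σ}, p.wp Q σ → p.wp Q' σ := by
  induction p generalizing Q Q' with
  | skip => exact fun h => hQ _ h
  | setNat a i e => exact fun h => hQ _ h
  | setReal a i e => exact fun h => hQ _ h
  | seq p q ihp ihq => exact fun h => ihp (fun σ => ihq hQ) h
  | branch b p q ihp ihq => exact fun h => ⟨fun hb => ihp hQ (h.1 hb), fun hb => ihq hQ (h.2 hb)⟩
  | loop b p => exact fun h => h.elim

/-- Sequential composition of a list of programs. -/
def block : List Program → Program
  | [] => skip
  | [p] => p
  | p :: q :: l => seq p (block (q :: l))

end Program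

/-- The scalar natural-number variable kept in cell `0` of array `a`. -/
abbrev NatExpr.var (a : ℕ) : NatExpr := .cell a (.lit 0)

/-- The scalar real variable kept in cell `0` of array `a`. -/
abbrev RealExpr.var (a : ℕ) : RealExpr := .cell a (.lit 0)

/-- Assignment to a scalar natural-number variable. -/
abbrev Program.letNat (a : ℕ) (e : NatExpr) : Program := .setNat a (.lit 0) e

/-- Assignment to a scalar real variable. -/
abbrev Program.letReal (a : ℕ) (e : RealExpr) : Program := .setReal a (.lit 0) e

/-- The test `e < f`. -/
abbrev Test.natLt (e f : NatExpr) : Test := .natLe (.add e (.lit 1)) f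

namespace RealExpr

/-- The maximum, computed without branching as `(x + y + |y - x|) / 2`, where the absolute value is
the square root of the square. -/
def max (e f : RealExpr) : RealExpr :=
  .div (.add (.add e f) (.sqrt (.mul (.sub f e) (.sub f e)))) (.lit 2)

/-- The minimum, computed without branching as `(x + y - |y - x|) / 2`. -/
def min (e f : RealExpr) : RealExpr :=
  .div (.sub (.add e f) (.sqrt (.mul (.sub f e) (.sub f e)))) (.lit 2)

@[simp] theorem eval_max (σ : Store) (e f : RealExpr) :
    (e.max f).eval σ = Max.max (e.eval σ) (f.eval σ) := by
  simp only [max, eval, Real.sqrt_mul_self_eq_abs]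
  rcases le_total (e.eval σ) (f.eval σ) with h | h
  · rw [abs_of_nonneg (by linarith), max_eq_right h]; push_cast; ring
  · rw [abs_of_nonpos (by linarith), max_eq_left h]; push_cast; ring

@[simp] theorem eval_min (σ : Store) (e f : RealExpr) :
    (e.min f).eval σ = Min.min (e.eval σ) (f.eval σ) := by
  simp only [min, eval, Real.sqrt_mul_self_eq_abs]
  rcases le_total (e.eval σ) (f.eval σ) with h | h
  · rw [abs_of_nonneg (by linarith), min_eq_left h]; push_cast; ring
  · rw [abs_of_nonpos (by linarith), min_eq_right h]; push_cast; ring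

end RealExpr

end RealRAM

/-! ### Sorting the actions by cost with a tournament tree -/

namespace RealRAM

/-- Every node `i ≥ s` of the tree holds one of the leaves below it. The tree has the nodes
`1, …, 2 * n - 1`; the children of `i` are `2 * i` and `2 * i + 1`, the leaf of item `l` is
`n + l`. -/
def IsBracket (n s : ℕ) (t : ℕ → ℕ) : Prop :=
  ∀ i, s ≤ i → i < 2 * n → t i < n ∧ ∃ k, (n + t i) / 2 ^ k = i

/-- The item at node `i` has a key that is at most those of the items at its two children. -/
def BeatsChildren (t : ℕ → ℕ) (key : ℕ → ℝ) (i : ℕ) : Prop :=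
  key (t i) ≤ key (t (2 * i)) ∧ key (t i) ≤ key (t (2 * i + 1))

theorem IsBracket.leaf {n s : ℕ} {t : ℕ → ℕ} (h : IsBracket n s t) {l : ℕ} (hs : s ≤ n)
    (hl : l < n) : t (n + l) = l := by
  obtain ⟨h1, k, hk⟩ := h (n + l) (by omega) (by omega)
  rcases k with _ | k
  · simp at hk; exact hk
  · have : (n + t (n + l)) / 2 ^ (k + 1) ≤ (n + t (n + l)) / 2 := by
      rw [pow_succ', ← Nat.div_div_eq_div_mul]
      exact Nat.div_le_self _ _
    omega

/-- If no node is beaten by its children, then the root is not beaten by any node. -/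
theorem root_le {n : ℕ} {t : ℕ → ℕ} {key : ℕ → ℝ}
    (h : ∀ i, 1 ≤ i → i < n → BeatsChildren t key i) :
    ∀ i, 1 ≤ i → i < 2 * n → key (t 1) ≤ key (t i) := by
  intro i
  induction i using Nat.strong_induction_on with
  | _ i ih =>
    intro h1 h2
    rcases Nat.lt_or_ge i 2 with h3 | h3
    · rw [show i = 1 by omega]
    · have h4 := ih (i / 2) (by omega) (by omega) (by omega)
      have h5 := h (i / 2) (by omega) (by omega)
      rcases Nat.even_or_odd' i with ⟨j, rfl | rfl⟩
      · rw [show 2 * j / 2 = j by omega] at h4 h5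
        exact h4.trans h5.1
      · rw [show (2 * j + 1) / 2 = j by omega] at h4 h5
        exact h4.trans h5.2

/-- The root of a bracket holds an item with the smallest key. -/
theorem IsBracket.root_le {n : ℕ} {t : ℕ → ℕ} {key : ℕ → ℝ} (ht : IsBracket n 1 t)
    (h : ∀ i, 1 ≤ i → i < n → BeatsChildren t key i) {l : ℕ} (hl : l < n) :
    key (t 1) ≤ key l := by
  have := RealRAM.root_le h (n + l) (by omega) (by omega)
  rwa [ht.leaf (by omega) hl] at this

/-- Storing at node `q` the item of one of its children keeps the bracket. -/
theorem IsBracket.update {n s q : ℕ} {t : ℕ → ℕ} (ht : IsBracket n s t) {j : ℕ}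
    (hj : j / 2 = q) (hsj : s ≤ j) (hjn : j < 2 * n) {s' : ℕ}
    (hs' : ∀ i, s' ≤ i → i ≠ q → s ≤ i) :
    IsBracket n s' (Function.update t q (t j)) := by
  intro i hi hin
  rcases eq_or_ne i q with rfl | hne
  · rw [Function.update_self]
    obtain ⟨h1, k, hk⟩ := ht j hsj hjn
    refine ⟨h1, k + 1, ?_⟩
    rw [pow_succ, ← Nat.div_div_eq_div_mul, hk, hj]
  · rw [Function.update_of_ne hne]
    exact ht i (hs' i hi hne) hin

/-- Recompute the item at node `q` (variable `3`): of the two items at its children, the one with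
the smaller key. The tree is kept in natural-number array `1`, the keys in real array `1`. -/
def playMatch : Program :=
  .branch (.realLe (.cell 1 (.cell 1 (.add (.var 3) (.var 3))))
      (.cell 1 (.cell 1 (.add (.add (.var 3) (.var 3)) (.lit 1)))))
    (.setNat 1 (.var 3) (.cell 1 (.add (.var 3) (.var 3))))
    (.setNat 1 (.var 3) (.cell 1 (.add (.add (.var 3) (.var 3)) (.lit 1))))

theorem wp_playMatch {σ : Store} {Q : Store → Prop}
    (h : ∀ j, (j = 2 * σ.nat 3 0 ∨ j = 2 * σ.nat 3 0 + 1) →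
      σ.real 1 (σ.nat 1 j) ≤ σ.real 1 (σ.nat 1 (2 * σ.nat 3 0)) →
      σ.real 1 (σ.nat 1 j) ≤ σ.real 1 (σ.nat 1 (2 * σ.nat 3 0 + 1)) →
      Q (σ.setNat 1 (σ.nat 3 0) (σ.nat 1 j))) :
    playMatch.wp Q σ := by
  simp only [playMatch, Program.wp, Test.Holds, RealExpr.eval, NatExpr.eval, ← two_mul]
  exact ⟨fun h' => h _ (.inl rfl) le_rfl h', fun h' => h _ (.inr rfl) (not_le.1 h').le le_rfl⟩

theorem BeatsChildren.update {t : ℕ → ℕ} {key : ℕ → ℝ} {q j i : ℕ}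
    (h : BeatsChildren t key i) (hiq : i ≠ q) (h2 : i ≠ q / 2) :
    BeatsChildren (Function.update t q (t j)) key i := by
  unfold BeatsChildren
  rw [Function.update_of_ne hiq, Function.update_of_ne (by omega),
    Function.update_of_ne (by omega)]
  exact h

theorem BeatsChildren.update_self {t : ℕ → ℕ} {key : ℕ → ℝ} {q j : ℕ} (hq : 1 ≤ q)
    (h1 : key (t j) ≤ key (t (2 * q))) (h2 : key (t j) ≤ key (t (2 * q + 1))) :
    BeatsChildren (Function.update t q (t j)) key q := by
  unfold BeatsChildren
  rw [Function.update_self, Function.update_of_ne (by omega), Function.update_of_ne (by omega)]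
  exact ⟨h1, h2⟩

/-- Walk from node `q` to the root and recompute all items on the way. -/
def replay : Program :=
  .loop (.natLe (.lit 2) (.var 3)) (.block [.letNat 3 (.half (.var 3)), playMatch])

/-- `replay` repairs a bracket in which only proper ancestors of `q` may be wrong, in time
logarithmic in the number of nodes. -/
theorem halts_replay {n : ℕ} {σ : Store} (hq : 1 ≤ σ.nat 3 0) (hqn : σ.nat 3 0 < 2 * n)
    (ht : IsBracket n 1 (σ.nat 1))
    (hb : ∀ i, 1 ≤ i → i < n → BeatsChildren (σ.nat 1) (σ.real 1) i ∨
      ∃ k, 1 ≤ k ∧ i = σ.nat 3 0 / 2 ^ k) :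
    Halts replay σ (Nat.log 2 (2 * n) + 1) (fun σ' =>
      σ'.real = σ.real ∧ (∀ a, a ≠ 1 → a ≠ 3 → σ'.nat a = σ.nat a) ∧ IsBracket n 1 (σ'.nat 1) ∧
      ∀ i, 1 ≤ i → i < n → BeatsChildren (σ'.nat 1) (σ'.real 1) i) := by
  refine (Halts.loop_wp (fun τ => (τ.real = σ.real ∧ (∀ a, a ≠ 1 → a ≠ 3 → τ.nat a = σ.nat a) ∧
      IsBracket n 1 (τ.nat 1) ∧ (∀ i, 1 ≤ i → i < n →
        BeatsChildren (τ.nat 1) (τ.real 1) i ∨ ∃ k, 1 ≤ k ∧ i = τ.nat 3 0 / 2 ^ k)) ∧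
      1 ≤ τ.nat 3 0 ∧ τ.nat 3 0 < 2 * n) (fun τ => Nat.log 2 (τ.nat 3 0)) ?_
      ⟨⟨rfl, fun _ _ _ => rfl, ht, hb⟩, hq, hqn⟩ (Nat.log_mono_right hqn.le)).mono le_rfl ?_
  · rintro τ ⟨⟨h1, h2, h3, h4⟩, h5, h6⟩ h7
    simp only [Test.Holds, NatExpr.eval] at h7
    simp only [Program.block, Program.wp, NatExpr.eval]
    apply wp_playMatch
    intro j hj
    simp only [Store.nat_setNat, Store.real_setNat, Function.update_self, if_true,
      OfNat.ofNat_ne_one, OfNat.one_ne_ofNat, if_false] at hj ⊢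
    intro hj1 hj2
    have hj' : j / 2 = τ.nat 3 0 / 2 := by omega
    refine ⟨⟨⟨h1, ?_, ?_, ?_⟩, ?_, ?_⟩, ?_⟩
    · intro a ha ha'
      simp [ha, ha', h2 a ha ha']
    · exact h3.update hj' (by omega) (by omega) (by omega)
    · intro i hi hin
      by_cases hiq : i = τ.nat 3 0 / 2
      · subst hiq
        exact .inl (BeatsChildren.update_self hi hj1 hj2)
      · by_cases hiq' : i = τ.nat 3 0 / 2 / 2
        · exact .inr ⟨1, le_rfl, by simpa using hiq'⟩
        · rcases h4 i hi hin with h | ⟨k, hk, rfl⟩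
          · exact .inl (h.update hiq hiq')
          · obtain ⟨k, rfl⟩ : ∃ k', k = k' + 1 := ⟨k - 1, by omega⟩
            refine .inr ⟨k, ?_, ?_⟩
            · rcases k with _ | k
              · simp at hiq
              · omega
            · simp [pow_succ', Nat.div_div_eq_div_mul]
    · omega
    · omega
    · rw [Nat.log_of_one_lt_of_le (n := τ.nat 3 0) (by omega) (by omega)]
      omega
  · rintro τ ⟨⟨⟨h1, h2, h3, h4⟩, h5, h6⟩, h7⟩
    simp only [Test.Holds, NatExpr.eval] at h7
    refine ⟨h1, h2, h3, fun i hi hin => (h4 i hi hin).resolve_right ?_⟩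
    rintro ⟨k, hk, rfl⟩
    rw [show τ.nat 3 0 = 1 by omega, Nat.div_eq_of_lt (Nat.one_lt_two_pow (by omega))] at hi
    omega

/-- What sorting and the construction of the envelope leave alone: the number `n` of actions, the
expected rewards `R` and the parameters `p`. -/
def Keeps (n : ℕ) (R p : ℕ → ℝ) (σ : Store) : Prop :=
  σ.nat 0 0 = n ∧ σ.real 0 = R ∧ σ.real 2 = p

/-- For `l = 0, …, n - 1` (variable `2`), put item `l` at leaf `n + l`, and compute in the real
variable `4` a number that exceeds all keys. -/
def enterLeaves : Program :=
  .block [.letReal 4 (.lit 1), .letNat 2 (.lit 0),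
    .loop (.natLt (.var 2) (.var 0)) (.block [.setNat 1 (.add (.var 0) (.var 2)) (.var 2),
      .letReal 4 (.add (.var 4) (.cell 1 (.var 2))), .letNat 2 (.add (.var 2) (.lit 1))])]

/-- Recompute all inner nodes, from the last one to the root. -/
def buildBracket : Program :=
  .block [.letNat 3 (.var 0), .loop (.natLe (.lit 2) (.var 3))
    (.block [.letNat 3 (.sub (.var 3) (.lit 1)), playMatch])]

theorem halts_enterLeaves {n : ℕ} {R c p : ℕ → ℝ} {σ : Store} (hk : Keeps n R p σ)
    (hc : σ.real 1 = c) (hpos : ∀ l < n, 0 ≤ c l) :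
    Halts enterLeaves σ (n + 1) (fun σ' => Keeps n R p σ' ∧ σ'.real 1 = c ∧
      IsBracket n n (σ'.nat 1) ∧ ∀ l < n, c l < σ'.real 4 0) := by
  refine Halts.seq_wp (by omega) (Halts.seq_wp (by omega) ?_)
  refine (Halts.loop_wp (fun τ => (Keeps n R p τ ∧ τ.real 1 = c ∧ τ.nat 2 0 ≤ n) ∧
        (∀ l < τ.nat 2 0, τ.nat 1 (n + l) = l) ∧ 1 ≤ τ.real 4 0 ∧
        ∀ l < τ.nat 2 0, c l < τ.real 4 0) (fun τ => n - τ.nat 2 0) ?_ ?_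
        (Nat.sub_le _ _)).mono le_rfl ?_
  · rintro τ ⟨⟨⟨rfl, h2, h3⟩, h4, h5⟩, h6, h7, h8⟩ h9
    simp only [Test.Holds, NatExpr.eval] at h9
    simp only [Program.block, Program.wp, NatExpr.eval, RealExpr.eval, Keeps]
    simp [h2, h3, h4]
    have hpos' := hpos _ h9
    refine ⟨⟨h9, ?_, ?_, ?_⟩, ?_⟩
    · intro l hl
      rcases eq_or_ne l (τ.nat 2 0) with rfl | hne
      · simp
      · rw [Function.update_of_ne (by omega)]
        exact h6 l (by omega)
    · linarith
    · intro l hl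
      rcases eq_or_ne l (τ.nat 2 0) with rfl | hne
      · linarith
      · have := h8 l (by omega)
        linarith
    · omega
  · simpa [NatExpr.eval, RealExpr.eval, Keeps, hc] using hk
  · rintro τ ⟨⟨⟨h1, h4, h5⟩, h6, h7, h8⟩, h9⟩
    simp only [Test.Holds, NatExpr.eval, h1.1] at h9
    refine ⟨h1, h4, fun i hi hin => ?_, fun l hl => h8 l (by omega)⟩
    have := h6 (i - n) (by omega)
    rw [Nat.add_sub_cancel' hi] at this
    rw [this]
    exact ⟨by omega, 0, by simp; omega⟩

theorem halts_buildBracket {n : ℕ} {R c p : ℕ → ℝ} {M : ℝ} {σ : Store} (hk : Keeps n R p σ)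
    (hc : σ.real 1 = c) (hM : σ.real 4 0 = M) (hn : 1 ≤ n) (ht : IsBracket n n (σ.nat 1)) :
    Halts buildBracket σ (n + 1) (fun σ' => (Keeps n R p σ' ∧ σ'.real 1 = c ∧ σ'.real 4 0 = M) ∧
      IsBracket n 1 (σ'.nat 1) ∧
      ∀ i, 1 ≤ i → i < n → BeatsChildren (σ'.nat 1) (σ'.real 1) i) := by
  refine Halts.seq_wp (by omega) ?_
  refine (Halts.loop_wp (fun τ => (Keeps n R p τ ∧ τ.real 1 = c ∧ τ.real 4 0 = M) ∧
      (1 ≤ τ.nat 3 0 ∧ τ.nat 3 0 ≤ n) ∧ IsBracket n (τ.nat 3 0) (τ.nat 1) ∧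
      ∀ i, τ.nat 3 0 ≤ i → i < n → BeatsChildren (τ.nat 1) (τ.real 1) i)
      (fun τ => τ.nat 3 0) ?_ ?_ ?_).mono le_rfl ?_
  · rintro τ ⟨⟨⟨h1, h2, h3⟩, h4, h5⟩, ⟨h6, h7⟩, h8, h9⟩ h10
    simp only [Test.Holds, NatExpr.eval] at h10
    simp only [Program.block, Program.wp, NatExpr.eval]
    apply wp_playMatch
    intro j hj
    simp only [Store.nat_setNat, Store.real_setNat, Function.update_self, if_true,
      OfNat.ofNat_ne_one, OfNat.one_ne_ofNat, if_false] at hj ⊢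
    intro hj1 hj2
    have hj' : j / 2 = τ.nat 3 0 - 1 := by omega
    refine ⟨⟨⟨⟨by simpa using h1, h2, h3⟩, h4, h5⟩, ?_, ?_, ?_⟩, by simp; omega⟩
    · omega
    · exact h8.update hj' (by omega) (by omega) (by omega)
    · intro i hi hin
      rcases eq_or_ne i (τ.nat 3 0 - 1) with rfl | hne
      · exact BeatsChildren.update_self (by omega) hj1 hj2
      · exact (h9 i (by omega) hin).update hne (by omega)
  · simp only [NatExpr.eval, hk.1]
    refine ⟨⟨⟨by simpa using hk.1, hk.2⟩, hc, hM⟩, ?_, ?_, ?_⟩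
    · simp; omega
    · simpa using ht
    · simp; omega
  · simp [NatExpr.eval, hk.1]
  · rintro τ ⟨⟨h1, h2, h3, h4⟩, h5⟩
    simp only [Test.Holds, NatExpr.eval] at h5
    rw [show τ.nat 3 0 = 1 by omega] at h3 h4
    exact ⟨h1, h3, h4⟩

/-- The pairs `(r k, s k)` for `k < n` are the pairs `(R l, c l)` for `l < n`, in the order of
increasing `c`. -/
structure SortedBy (n : ℕ) (R c r s : ℕ → ℝ) : Prop where
  mem : ∀ l < n, ∃ k < n, r k = R l ∧ s k = c l
  origin : ∀ k < n, ∃ l < n, r k = R l ∧ s k = c l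
  mono : ∀ k k', k < k' → k' < n → s k < s k'

/-- The situation after `k` extractions: the extracted items have got the key `M`, which exceeds
all values of `c`, and are listed in `r`, `s`; they precede all others, and there are `k` of
them. -/
structure Extracted (n : ℕ) (R c : ℕ → ℝ) (M : ℝ) (k : ℕ) (key r s : ℕ → ℝ) : Prop where
  cases : ∀ l < n, key l = c l ∨ key l = M ∧ ∃ k' < k, r k' = R l ∧ s k' = c l
  origin : ∀ k' < k, ∃ l < n, r k' = R l ∧ s k' = c l
  before : ∀ k' < k, ∀ l < n, key l < M → s k' < c l
  mono : ∀ k' k'', k' < k'' → k'' < k → s k' < s k''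
  card : ((Finset.range n).filter (fun l => key l < M)).card + k = n

theorem Extracted.step {n k w : ℕ} {R c key r s : ℕ → ℝ} {M : ℝ}
    (h : Extracted n R c M k key r s)
    (hc : ∀ l < n, ∀ l' < n, c l = c l' → l = l') (hk : k < n) (hw : w < n)
    (hmin : ∀ l < n, key w ≤ key l) :
    Extracted n R c M (k + 1) (Function.update key w M) (Function.update r k (R w))
      (Function.update s k (key w)) := by
  have hwM : key w < M := by
    have h1 : 0 < ((Finset.range n).filter (fun l => key l < M)).card := by
      have := h.card; omega
    obtain ⟨l, hl⟩ := Finset.card_pos.1 h1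
    rw [Finset.mem_filter, Finset.mem_range] at hl
    exact (hmin l hl.1).trans_lt hl.2
  have hcw : key w = c w := (h.cases w hw).resolve_right fun h' => hwM.ne h'.1
  refine ⟨fun l hl => ?_, fun k' hk' => ?_, fun k' hk' l hl hlM => ?_,
    fun k' k'' hkk hk'' => ?_, ?_⟩
  · rcases eq_or_ne l w with rfl | hne
    · exact .inr ⟨by simp, k, by omega, by simp, by simp [hcw]⟩
    · rw [Function.update_of_ne hne]
      refine (h.cases l hl).imp_right fun ⟨h1, k', hk', h2⟩ => ⟨h1, k', by omega, ?_⟩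
      rwa [Function.update_of_ne (by omega), Function.update_of_ne (by omega)]
  · rcases eq_or_ne k' k with rfl | hne
    · exact ⟨w, hw, by simp, by simp [hcw]⟩
    · rw [Function.update_of_ne hne, Function.update_of_ne hne]
      exact h.origin k' (by omega)
  · rcases eq_or_ne l w with rfl | hlw
    · simp at hlM
    rw [Function.update_of_ne hlw] at hlM
    rcases eq_or_ne k' k with rfl | hne
    · have h1 := hmin l hl
      have h2 : key l = c l := (h.cases l hl).resolve_right fun h' => hlM.ne h'.1
      rw [Function.update_self, hcw]
      rw [hcw, h2] at h1
      exact h1.lt_of_ne fun h3 => hlw (hc _ hw _ hl h3).symm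
    · rw [Function.update_of_ne hne]
      exact h.before k' (by omega) l hl hlM
  · rw [Function.update_of_ne (by omega : k' ≠ k)]
    rcases eq_or_ne k'' k with rfl | hne
    · rw [Function.update_self, hcw]
      exact h.before k' (by omega) w hw hwM
    · rw [Function.update_of_ne hne]
      exact h.mono k' k'' hkk (by omega)
  · have h1 : (Finset.range n).filter (fun l => Function.update key w M l < M) =
        ((Finset.range n).filter (fun l => key l < M)).erase w := by
      ext l
      rcases eq_or_ne l w with rfl | hne
      · simp
      · simp [hne]
    rw [h1]
    have h2 := Finset.card_erase_add_one
      (show w ∈ (Finset.range n).filter (fun l => key l < M) by simp [hw, hwM])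
    have := h.card
    omega

theorem Extracted.sortedBy {n : ℕ} {R c key r s : ℕ → ℝ} {M : ℝ}
    (h : Extracted n R c M n key r s) (hM : ∀ l < n, c l < M) : SortedBy n R c r s := by
  refine ⟨fun l hl => ?_, h.origin, h.mono⟩
  have h1 := h.card
  have h2 : ((Finset.range n).filter (fun l => key l < M)) = ∅ :=
    Finset.card_eq_zero.1 (by omega)
  have h3 : ¬ key l < M := fun h3 => by
    have : l ∈ (Finset.range n).filter (fun l => key l < M) := by simp [hl, h3]
    simp [h2] at this
  rcases h.cases l hl with h4 | h4
  · exact (h3 (h4 ▸ hM l hl)).elim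
  · exact h4.2

theorem BeatsChildren.raise_key {t : ℕ → ℕ} {key : ℕ → ℝ} {i w : ℕ} {M : ℝ}
    (h : BeatsChildren t key i) (hi : t i ≠ w) (hM : key w ≤ M) :
    BeatsChildren t (Function.update key w M) i := by
  have hle : ∀ l, key l ≤ Function.update key w M l := fun l => by
    rcases eq_or_ne l w with rfl | hne
    · simpa using hM
    · simp [hne]
  unfold BeatsChildren
  rw [Function.update_of_ne hi]
  exact ⟨h.1.trans (hle _), h.2.trans (hle _)⟩

/-- Move `n` times the item at the root (variable `7`) to the sorted list in the real arrays `5` and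
`6`, raise its key to the value of the real variable `4`, and repair the bracket. -/
def extractAll : Program :=
  .block [.letNat 2 (.lit 0), .loop (.natLt (.var 2) (.var 0)) (.block
    [.letNat 7 (.cell 1 (.lit 1)), .setReal 5 (.var 2) (.cell 0 (.var 7)),
      .setReal 6 (.var 2) (.cell 1 (.var 7)), .setReal 1 (.var 7) (.var 4),
      .letNat 3 (.add (.var 0) (.var 7)), replay, .letNat 2 (.add (.var 2) (.lit 1))])]

theorem halts_extractAll {n : ℕ} {R c p : ℕ → ℝ} {M : ℝ} {σ : Store} (hk : Keeps n R p σ)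
    (hc : σ.real 1 = c) (hM : σ.real 4 0 = M) (hn : 1 ≤ n) (hcM : ∀ l < n, c l < M)
    (hinj : ∀ l < n, ∀ l' < n, c l = c l' → l = l') (ht : IsBracket n 1 (σ.nat 1))
    (hb : ∀ i, 1 ≤ i → i < n → BeatsChildren (σ.nat 1) (σ.real 1) i) :
    Halts extractAll σ ((Nat.log 2 (2 * n) + 1) * (n + 1)) (fun σ' => Keeps n R p σ' ∧
      SortedBy n R c (σ'.real 5) (σ'.real 6)) := by
  refine Halts.seq_wp (by positivity) ?_
  refine (Halts.loop (fun τ => (Keeps n R p τ ∧ τ.real 4 0 = M) ∧ IsBracket n 1 (τ.nat 1) ∧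
      (∀ i, 1 ≤ i → i < n → BeatsChildren (τ.nat 1) (τ.real 1) i) ∧ τ.nat 2 0 ≤ n ∧
      Extracted n R c M (τ.nat 2 0) (τ.real 1) (τ.real 5) (τ.real 6)) (fun τ => n - τ.nat 2 0)
      (by positivity) ?_ ?_ (Nat.sub_le _ _)).mono le_rfl ?_
  · rintro τ ⟨⟨⟨rfl, rfl, rfl⟩, h4⟩, h5, h6, h7, h8⟩ h9
    simp only [Test.Holds, NatExpr.eval] at h9
    obtain ⟨hw, -⟩ := h5 1 le_rfl (by omega)
    have hmin : ∀ l < τ.nat 0 0, τ.real 1 (τ.nat 1 1) ≤ τ.real 1 l := fun l hl =>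
      h5.root_le h6 hl
    have hstep := h8.step hinj h9 hw hmin
    refine Halts.seq_wp (by positivity) <| Halts.seq_wp (by positivity) <|
      Halts.seq_wp (by positivity) <| Halts.seq_wp (by positivity) <|
      Halts.seq_wp (by positivity) ?_
    refine Halts.seq (by positivity) (halts_replay (n := τ.nat 0 0) ?_ ?_ ?_ ?_) ?_
    · simp [NatExpr.eval]; omega
    · simp [NatExpr.eval]; omega
    · simpa [NatExpr.eval] using h5
    · intro i hi hin
      simp only [NatExpr.eval, RealExpr.eval, Store.nat_setNat, Store.nat_setReal,
        Store.real_setNat, Store.real_setReal]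
      simp
      obtain ⟨-, k, hk'⟩ := h5 i hi (by omega)
      by_cases hiw : τ.nat 1 i = τ.nat 1 1
      · refine .inr ⟨k, ?_, by rw [← hiw, hk']⟩
        rcases k with _ | k
        · simp at hk'; omega
        · omega
      · refine .inl ((h6 i hi hin).raise_key hiw ?_)
        rw [h4]
        rcases h8.cases _ hw with h | h
        · exact h ▸ (hcM _ hw).le
        · exact h.1.le
    · rintro υ ⟨h10, h11, h12, h13⟩
      apply halts_of_wp (by positivity)
      have e2 : υ.nat 2 0 = τ.nat 2 0 := by simp [h11]
      have e0 : υ.nat 0 0 = τ.nat 0 0 := by simp [h11]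
      have r0 : υ.real 0 = τ.real 0 := by simp [h10]
      have r2 : υ.real 2 = τ.real 2 := by simp [h10]
      have r4 : υ.real 4 0 = M := by simp [h10, h4]
      have r1 : υ.real 1 = Function.update (τ.real 1) (τ.nat 1 1) M := by
        simp [h10, h4, NatExpr.eval, RealExpr.eval]
      have r5 : υ.real 5 =
          Function.update (τ.real 5) (τ.nat 2 0) (τ.real 0 (τ.nat 1 1)) := by
        simp [h10, NatExpr.eval, RealExpr.eval]
      have r6 : υ.real 6 =
          Function.update (τ.real 6) (τ.nat 2 0) (τ.real 1 (τ.nat 1 1)) := by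
        simp [h10, NatExpr.eval, RealExpr.eval]
      simp only [Program.block, Program.wp, NatExpr.eval, Keeps, Store.nat_setNat,
        Store.real_setNat]
      simp only [e0, e2, r0, r2, r4, r5, r6, Function.update_self, if_true,
        OfNat.zero_ne_ofNat, OfNat.one_ne_ofNat, if_false, true_and]
      refine ⟨⟨h12, h13, h9, r1 ▸ hstep⟩, by omega⟩
  · simp [NatExpr.eval]
    refine ⟨⟨by simpa [Keeps] using hk, hM⟩, ht, hb, ?_⟩
    refine ⟨by simp [hc], by simp, by simp, by simp, ?_⟩
    rw [Finset.filter_true_of_mem]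
    · simp
    · intro l hl
      rw [hc]
      exact hcM l (Finset.mem_range.1 hl)
  · rintro τ ⟨⟨⟨h1, h2⟩, h3, h4, h5, h6⟩, h7⟩
    simp only [Test.Holds, NatExpr.eval, h1.1] at h7
    rw [show τ.nat 2 0 = n by omega] at h6
    exact ⟨h1, h6.sortedBy hcM⟩

/-- List the actions in the order of increasing costs, the rewards in array `5` and the costs in
array `6`. -/
def sort : Program := .block [enterLeaves, buildBracket, extractAll]

theorem halts_sort {n : ℕ} {R c p : ℕ → ℝ} {σ : Store} (hk : Keeps n R p σ)
    (hc : σ.real 1 = c) (hn : 1 ≤ n) (hpos : ∀ l < n, 0 ≤ c l)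
    (hinj : ∀ l < n, ∀ l' < n, c l = c l' → l = l') :
    Halts sort σ ((Nat.log 2 (2 * n) + 1) * (n + 1)) (fun σ' => Keeps n R p σ' ∧
      SortedBy n R c (σ'.real 5) (σ'.real 6)) := by
  have hW : n + 1 ≤ (Nat.log 2 (2 * n) + 1) * (n + 1) := Nat.le_mul_of_pos_left _ (by omega)
  refine Halts.seq (by positivity) ((halts_enterLeaves hk hc hpos).mono hW fun _ h => h) ?_
  rintro τ ⟨h1, h2, h3, h4⟩
  refine Halts.seq (by positivity) ((halts_buildBracket h1 h2 rfl hn h3).mono hW fun _ h => h) ?_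
  rintro υ ⟨⟨h5, h6, h7⟩, h8, h9⟩
  exact halts_extractAll h5 h6 h7 hn h4 hinj h8 h9

/-! ### The upper envelope of the utility lines -/

/-- The lines `x ↦ r k * x - c k`, `k < m`, in the order of increasing slopes, of which line `0` is
zero; `b (k + 1)` is where the lines `k` and `k + 1` meet, and the meeting points increase, so that
line `k` is the highest one between `b k` and `b (k + 1)`. The number `b 0` has no meaning. -/
structure Envelope (m : ℕ) (r c b : ℕ → ℝ) : Prop where
  pos : 1 ≤ m
  slope_zero : r 0 = 0
  cost_zero : c 0 = 0
  slope_lt : ∀ k, k + 1 < m → r k < r (k + 1)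
  meet : ∀ k, k + 1 < m → b (k + 1) * (r (k + 1) - r k) = c (k + 1) - c k
  meet_nonneg : ∀ k < m, 0 ≤ b k
  meet_lt : ∀ k, k + 2 < m → b (k + 1) < b (k + 2)

namespace Envelope

variable {m : ℕ} {r c b : ℕ → ℝ}

theorem slope_mono (h : Envelope m r c b) {j k : ℕ} (hjk : j ≤ k) (hk : k < m) : r j ≤ r k := by
  induction k, hjk using Nat.le_induction with
  | base => exact le_rfl
  | succ k hjk ih => exact (ih (by omega)).trans (h.slope_lt k hk).le

theorem slope_pos (h : Envelope m r c b) {k : ℕ} (h1 : 1 ≤ k) (hk : k < m) : 0 < r k := by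
  have h2 := h.slope_lt 0 (by omega)
  rw [h.slope_zero] at h2
  exact h2.trans_le (h.slope_mono h1 hk)

theorem cost_mono (h : Envelope m r c b) {j k : ℕ} (hjk : j ≤ k) (hk : k < m) : c j ≤ c k := by
  induction k, hjk using Nat.le_induction with
  | base => exact le_rfl
  | succ k hjk ih =>
    have h1 := h.meet k hk
    have h2 := mul_nonneg (h.meet_nonneg _ hk) (sub_nonneg.2 (h.slope_lt k hk).le)
    linarith [ih (by omega)]

theorem meet_mono (h : Envelope m r c b) {j k : ℕ} (h1 : 1 ≤ j) (hjk : j ≤ k) (hk : k < m) :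
    b j ≤ b k := by
  induction k, hjk using Nat.le_induction with
  | base => exact le_rfl
  | succ k hjk ih =>
    obtain ⟨k, rfl⟩ : ∃ k', k = k' + 1 := ⟨k - 1, by omega⟩
    exact (ih (by omega)).trans (h.meet_lt k hk).le

theorem le_of_meet_le (h : Envelope m r c b) {j k : ℕ} {x : ℝ} (hjk : j ≤ k) (hk : k < m)
    (hx : b k ≤ x) : r j * x - c j ≤ r k * x - c k := by
  induction k, hjk using Nat.le_induction with
  | base => exact le_rfl
  | succ k hjk ih =>
    have h1 := h.meet k hk
    have h2 := mul_le_mul_of_nonneg_right hx (sub_nonneg.2 (h.slope_lt k hk).le)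
    have h3 : r k * x - c k ≤ r (k + 1) * x - c (k + 1) := by linarith
    rcases Nat.eq_zero_or_pos k with rfl | hk0
    · rw [show j = 0 by omega]; exact h3
    · exact (ih (by omega) ((h.meet_mono hk0 (by omega) hk).trans hx)).trans h3

theorem le_of_le_meet (h : Envelope m r c b) {j k : ℕ} {x : ℝ} (hkj : k ≤ j) (hj : j < m)
    (hx : x ≤ b (k + 1)) : r j * x - c j ≤ r k * x - c k := by
  induction j, hkj using Nat.le_induction with
  | base => exact le_rfl
  | succ j hkj ih =>
    have h1 := h.meet j hj
    have h2 := mul_le_mul_of_nonneg_right (hx.trans (h.meet_mono (by omega) (by omega) hj))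
      (sub_nonneg.2 (h.slope_lt j hj).le)
    exact le_trans (by linarith) (ih (by omega))

/-- Line `k` is the highest one between `b k` and `b (k + 1)`. -/
theorem le_line (h : Envelope m r c b) {j k : ℕ} {x : ℝ} (hj : j < m) (hk : k < m)
    (hx : b k ≤ x) (hx' : x ≤ b (k + 1)) : r j * x - c j ≤ r k * x - c k := by
  rcases le_total j k with hjk | hjk
  · exact h.le_of_meet_le hjk hk hx
  · exact h.le_of_le_meet hjk hj hx'

theorem pop (h : Envelope m r c b) (hm : 2 ≤ m) : Envelope (m - 1) r c b :=
  ⟨by omega, h.slope_zero, h.cost_zero, fun k hk => h.slope_lt k (by omega),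
    fun k hk => h.meet k (by omega), fun k hk => h.meet_nonneg k (by omega),
    fun k hk => h.meet_lt k (by omega)⟩

theorem push (h : Envelope m r c b) {ρ χ e : ℝ} (hρ : r (m - 1) < ρ)
    (he : e * (ρ - r (m - 1)) = χ - c (m - 1)) (he0 : 0 ≤ e) (hb : 2 ≤ m → b (m - 1) < e) :
    Envelope (m + 1) (Function.update r m ρ) (Function.update c m χ)
      (Function.update b m e) := by
  have hp := h.pos
  refine ⟨by omega, ?_, ?_, fun k hk => ?_, fun k hk => ?_, fun k hk => ?_, fun k hk => ?_⟩
  · rw [Function.update_of_ne (by omega), h.slope_zero]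
  · rw [Function.update_of_ne (by omega), h.cost_zero]
  · rw [Function.update_of_ne (by omega : k ≠ m)]
    rcases eq_or_ne (k + 1) m with rfl | hne
    · simpa using hρ
    · rw [Function.update_of_ne hne]
      exact h.slope_lt k (by omega)
  · rw [Function.update_of_ne (by omega : k ≠ m), Function.update_of_ne (by omega : k ≠ m)]
    rcases eq_or_ne (k + 1) m with rfl | hne
    · simpa using he
    · rw [Function.update_of_ne hne, Function.update_of_ne hne, Function.update_of_ne hne]
      exact h.meet k (by omega)
  · rcases eq_or_ne k m with rfl | hne
    · simpa using he0
    · rw [Function.update_of_ne hne]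
      exact h.meet_nonneg k (by omega)
  · rw [Function.update_of_ne (by omega : k + 1 ≠ m)]
    rcases eq_or_ne (k + 2) m with rfl | hne
    · simpa using hb (by omega)
    · rw [Function.update_of_ne hne]
      exact h.meet_lt k (by omega)

/-- If a steeper line meets the last line of the envelope before the last but one does, then the
last line is nowhere above both. -/
theorem last_le (h : Envelope m r c b) (hm : 2 ≤ m) {ρ χ e : ℝ} (hρ : r (m - 1) < ρ)
    (he : e * (ρ - r (m - 1)) = χ - c (m - 1)) (hb : e ≤ b (m - 1)) (x : ℝ) :
    r (m - 1) * x - c (m - 1) ≤ r (m - 2) * x - c (m - 2) ∨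
      r (m - 1) * x - c (m - 1) ≤ ρ * x - χ := by
  rcases le_total x (b (m - 1)) with hx | hx
  · left
    refine h.le_of_le_meet (by omega) (by omega) ?_
    rwa [show m - 2 + 1 = m - 1 by omega]
  · right
    have := mul_le_mul_of_nonneg_right (hb.trans hx) (sub_nonneg.2 hρ.le)
    linarith

end Envelope

/-- The lines `x ↦ r k * x - c k`, `k < m`, are among the lines `x ↦ R l * x - C l`, `l < n`, apart
from line `0`. -/
def LinesAmong (m : ℕ) (r c : ℕ → ℝ) (n : ℕ) (R C : ℕ → ℝ) : Prop :=
  ∀ k, 1 ≤ k → k < m → ∃ l < n, r k = R l ∧ c k = C l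

/-- One step of the construction of the envelope. The envelope is a stack of `m` lines (variable
`4`), kept in the arrays `7` (slopes), `8` (costs) and `9` (meeting points); the next line is line
`i` (variable `2`) of the sorted list. A line with slope `0` is skipped, the last line of the
stack is discarded if it is superfluous, and otherwise the new line is added. -/
def envelopeStep : Program :=
  .branch (.realLe (.cell 5 (.var 2)) (.lit 0)) (.letNat 2 (.add (.var 2) (.lit 1))) (.block
    [.letReal 10 (.div (.sub (.cell 6 (.var 2)) (.cell 8 (.sub (.var 4) (.lit 1))))
        (.sub (.cell 5 (.var 2)) (.cell 7 (.sub (.var 4) (.lit 1))))),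
      .branch (.conj (.natLe (.lit 2) (.var 4))
          (.realLe (.var 10) (.cell 9 (.sub (.var 4) (.lit 1)))))
        (.letNat 4 (.sub (.var 4) (.lit 1)))
        (.block [.setReal 7 (.var 4) (.cell 5 (.var 2)), .setReal 8 (.var 4) (.cell 6 (.var 2)),
          .setReal 9 (.var 4) (.var 10), .letNat 4 (.add (.var 4) (.lit 1)),
          .letNat 2 (.add (.var 2) (.lit 1))])])

/-- Compute the envelope of the zero line and the lines in the arrays `5` and `6`, and end the list
of meeting points with a number above `1`. -/
def buildEnvelope : Program :=
  .block [.letNat 4 (.lit 1), .letNat 2 (.lit 0), .letReal 7 (.lit 0), .letReal 8 (.lit 0),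
    .letReal 9 (.lit 0), .loop (.natLt (.var 2) (.var 0)) envelopeStep,
    .setReal 9 (.var 4) (.lit 2)]

/-- The situation when the first `i` lines of the sorted list have been dealt with; the lines that
they have displaced from the stack may be covered by line `i`, if that is about to be added. -/
structure PartialEnvelope (n : ℕ) (R C : ℕ → ℝ) (i m : ℕ) (r c b : ℕ → ℝ) : Prop where
  env : Envelope m r c b
  among : LinesAmong m r c i R C
  cover : ∀ l < i, ∀ x : ℝ, (∃ k < m, R l * x - C l ≤ r k * x - c k) ∨
    (i < n ∧ 0 < R i ∧ R l * x - C l ≤ R i * x - C i)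

namespace PartialEnvelope

variable {n i m : ℕ} {R C r c b : ℕ → ℝ}

theorem skip (h : PartialEnvelope n R C i m r c b) (hi : R i = 0) (hC : 0 ≤ C i) :
    PartialEnvelope n R C (i + 1) m r c b := by
  refine ⟨h.env, fun k h1 hk => ?_, fun l hl x => .inl ?_⟩
  · obtain ⟨l, hl, h2⟩ := h.among k h1 hk
    exact ⟨l, by omega, h2⟩
  · rcases Nat.lt_succ_iff_lt_or_eq.1 hl with h1 | rfl
    · exact (h.cover l h1 x).resolve_right fun h2 => h2.2.1.ne' hi
    · refine ⟨0, h.env.pos, ?_⟩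
      rw [hi, h.env.slope_zero, h.env.cost_zero]
      linarith

theorem last_slope_lt (h : PartialEnvelope n R C i m r c b) (hi : 0 < R i)
    (hmono : ∀ l < i, R l < R i) : r (m - 1) < R i := by
  rcases Nat.lt_or_ge 1 m with h1 | h1
  · obtain ⟨l, hl, h2, -⟩ := h.among (m - 1) (by omega) (by have := h.env.pos; omega)
    rw [h2]
    exact hmono l hl
  · rw [show m - 1 = 0 by omega, h.env.slope_zero]
    exact hi

theorem pop (h : PartialEnvelope n R C i m r c b) (hin : i < n) (hi : 0 < R i)
    (hmono : ∀ l < i, R l < R i) (hm : 2 ≤ m)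
    (hb : (C i - c (m - 1)) / (R i - r (m - 1)) ≤ b (m - 1)) :
    PartialEnvelope n R C i (m - 1) r c b := by
  have hlt := h.last_slope_lt hi hmono
  refine ⟨h.env.pop hm, fun k h1 hk => h.among k h1 (by omega), fun l hl x => ?_⟩
  rcases h.cover l hl x with ⟨k, hk, h1⟩ | h1
  · by_cases hkm : k < m - 1
    · exact .inl ⟨k, hkm, h1⟩
    · rw [show k = m - 1 by omega] at h1
      rcases h.env.last_le hm hlt (div_mul_cancel₀ _ (sub_pos.2 hlt).ne') hb x with h2 | h2
      · exact .inl ⟨m - 2, by omega, h1.trans h2⟩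
      · exact .inr ⟨hin, hi, h1.trans h2⟩
  · exact .inr h1

theorem push (h : PartialEnvelope n R C i m r c b) (hi : 0 < R i) (hC : 0 ≤ C i)
    (hmono : ∀ l < i, R l < R i)
    (hb : 2 ≤ m → b (m - 1) < (C i - c (m - 1)) / (R i - r (m - 1))) :
    PartialEnvelope n R C (i + 1) (m + 1) (Function.update r m (R i)) (Function.update c m (C i))
      (Function.update b m ((C i - c (m - 1)) / (R i - r (m - 1)))) := by
  have hlt := h.last_slope_lt hi hmono
  have hp := h.env.pos
  refine ⟨h.env.push hlt (div_mul_cancel₀ _ (sub_pos.2 hlt).ne') ?_ hb, fun k h1 hk => ?_,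
    fun l hl x => .inl ?_⟩
  · rcases Nat.lt_or_ge 1 m with h1 | h1
    · exact (h.env.meet_nonneg _ (by omega)).trans (hb h1).le
    · rw [show m - 1 = 0 by omega, h.env.slope_zero, h.env.cost_zero, sub_zero, sub_zero]
      positivity
  · rcases eq_or_ne k m with rfl | hne
    · exact ⟨i, by omega, by simp, by simp⟩
    · rw [Function.update_of_ne hne, Function.update_of_ne hne]
      obtain ⟨l, hl, h2⟩ := h.among k h1 (by omega)
      exact ⟨l, by omega, h2⟩
  · have hlast : ∀ {y : ℝ}, y ≤ R i * x - C i → ∃ k < m + 1,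
        y ≤ Function.update r m (R i) k * x - Function.update c m (C i) k := fun hy =>
      ⟨m, by omega, by simpa using hy⟩
    rcases Nat.lt_succ_iff_lt_or_eq.1 hl with h1 | rfl
    · rcases h.cover l h1 x with ⟨k, hk, h2⟩ | h2
      · refine ⟨k, by omega, ?_⟩
        rwa [Function.update_of_ne hk.ne, Function.update_of_ne hk.ne]
      · exact hlast h2.2.2
    · exact hlast le_rfl

end PartialEnvelope

theorem halts_buildEnvelope {n : ℕ} {R p S C : ℕ → ℝ} {σ : Store} (hk : Keeps n R p σ)
    (hS : σ.real 5 = S) (hC : σ.real 6 = C) (hS0 : ∀ l < n, 0 ≤ S l) (hC0 : ∀ l < n, 0 ≤ C l)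
    (hmono : ∀ l l', l < l' → l' < n → S l < S l') :
    Halts buildEnvelope σ (2 * n + 2) (fun σ' => Keeps n R p σ' ∧ σ'.nat 4 0 ≤ n + 1 ∧
      Envelope (σ'.nat 4 0) (σ'.real 7) (σ'.real 8) (σ'.real 9) ∧
      1 < σ'.real 9 (σ'.nat 4 0) ∧ LinesAmong (σ'.nat 4 0) (σ'.real 7) (σ'.real 8) n S C ∧
      ∀ l < n, ∀ x : ℝ, ∃ k < σ'.nat 4 0,
        S l * x - C l ≤ σ'.real 7 k * x - σ'.real 8 k) := by
  refine Halts.seq_wp (by omega) <| Halts.seq_wp (by omega) <| Halts.seq_wp (by omega) <|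
    Halts.seq_wp (by omega) <| Halts.seq_wp (by omega) ?_
  refine Halts.seq (by omega) (Halts.loop_wp (N := 2 * n + 1) (fun τ => (Keeps n R p τ ∧
    τ.real 5 = S ∧ τ.real 6 = C) ∧ (τ.nat 2 0 ≤ n ∧ τ.nat 4 0 ≤ τ.nat 2 0 + 1) ∧
    PartialEnvelope n S C (τ.nat 2 0) (τ.nat 4 0) (τ.real 7) (τ.real 8) (τ.real 9))
    (fun τ => 2 * (n - τ.nat 2 0) + τ.nat 4 0) ?_ ?_ ?_) ?_
  · rintro τ ⟨⟨⟨rfl, rfl, rfl⟩, rfl, rfl⟩, ⟨h1, h2⟩, h3⟩ h4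
    simp only [Test.Holds, NatExpr.eval] at h4
    have hm : ∀ l < τ.nat 2 0, τ.real 5 l < τ.real 5 (τ.nat 2 0) :=
      fun l hl => hmono l _ hl h4
    have hp := h3.env.pos
    refine ⟨fun h5 => ?_, fun h5 => ?_⟩
    · have h6 := h3.skip (le_antisymm (by simpa [Test.Holds, RealExpr.eval, NatExpr.eval] using h5)
        (hS0 _ h4)) (hC0 _ h4)
      simp [Program.wp, NatExpr.eval, Keeps]
      exact ⟨⟨⟨h4, by omega⟩, h6⟩, by omega⟩
    · have h5' : 0 < τ.real 5 (τ.nat 2 0) := by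
        simpa [Test.Holds, RealExpr.eval, NatExpr.eval] using h5
      refine ⟨fun h6 => ?_, fun h6 => ?_⟩
      · simp [Test.Holds, RealExpr.eval, NatExpr.eval] at h6
        have h7 := h3.pop h4 h5' hm h6.1 h6.2
        simp [Program.wp, NatExpr.eval, RealExpr.eval, Keeps]
        exact ⟨⟨⟨h1, by omega⟩, h7⟩, by omega⟩
      · simp [Test.Holds, RealExpr.eval, NatExpr.eval] at h6
        have h7 := h3.push h5' (hC0 _ h4) hm h6
        simp [Program.wp, Program.block, NatExpr.eval, RealExpr.eval, Keeps]
        exact ⟨⟨⟨h4, by omega⟩, h7⟩, by omega⟩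
  · simp [NatExpr.eval, RealExpr.eval, hS, hC]
    refine ⟨by simpa [Keeps] using hk, ?_⟩
    exact ⟨⟨le_rfl, by simp, by simp, by simp, by simp, by simp, by simp⟩,
      fun k h1 hk => by omega, by simp⟩
  · simp [NatExpr.eval, RealExpr.eval]
  · rintro τ ⟨⟨⟨h1, h2, h3⟩, ⟨h4, h5⟩, h6⟩, h7⟩
    simp only [Test.Holds, NatExpr.eval, h1.1] at h7
    rw [show τ.nat 2 0 = n by omega] at h5 h6
    apply halts_of_wp (by omega)
    simp only [Program.block, Program.wp, NatExpr.eval, RealExpr.eval, Store.nat_setReal, Keeps,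
      Store.real_setReal]
    simp only [if_true, OfNat.zero_ne_ofNat, if_false, Function.update_self, Nat.reduceEqDiff]
    refine ⟨h1, h5, ?_, ?_, h6.among, fun l hl x => ?_⟩
    · have h8 := h6.env
      refine ⟨h8.pos, h8.slope_zero, h8.cost_zero, h8.slope_lt, fun k hk => ?_, fun k hk => ?_,
        fun k hk => ?_⟩
      · rw [Function.update_of_ne (by omega)]; exact h8.meet k hk
      · rw [Function.update_of_ne (by omega)]; exact h8.meet_nonneg k hk
      · rw [Function.update_of_ne (by omega), Function.update_of_ne (by omega)]
        exact h8.meet_lt k hk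
    · norm_num
    · exact (h6.cover l hl x).resolve_right fun h8 => absurd h8.1 (lt_irrefl _)

/-! ### The cheapest contract for a pair of lines -/

/-- The least inspection probability `β` with `(1 - β) * P * γ ≤ R * γ - D`. Division by zero makes
this `0` if `P * γ = 0`, as it should be: then there is nothing to deter. -/
noncomputable def leastInspection (R P D γ : ℝ) : ℝ :=
  max 0 ((D - (R - P) * γ) / (P * γ))

theorem leastInspection_le_iff {R P D γ β : ℝ} (hP : 0 ≤ P) (hγ : 0 ≤ γ) (hD : D ≤ R * γ)
    (hβ : 0 ≤ β) : leastInspection R P D γ ≤ β ↔ (1 - β) * P * γ ≤ R * γ - D := by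
  unfold leastInspection
  rcases (mul_nonneg hP hγ).eq_or_lt with h | h
  · rw [← h, div_zero, max_self, mul_assoc, ← h, mul_zero]
    exact ⟨fun _ => by linarith, fun _ => hβ⟩
  · rw [max_le_iff, div_le_iff₀ h]
    exact ⟨fun h' => by linarith [h'.2], fun h' => ⟨hβ, by linarith⟩⟩

theorem leastInspection_nonneg (R P D γ : ℝ) : 0 ≤ leastInspection R P D γ := le_max_left _ _

/-- The point of the interval from `lo` to `hi` at which `R * γ + ι * leastInspection R P D γ` is
least. That function decreases up to the smaller one of the stationary point `√(ι D / (R P))` and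
the point `D / (R - P)` where no inspection is needed any more, and increases from there on. -/
noncomputable def cheapestShare (ι R P D lo hi : ℝ) : ℝ :=
  max lo (min hi (min (√(ι * D / (R * P))) (D / (R - P))))

theorem cheapestShare_spec {ι R P D lo hi γ : ℝ} (hι : 0 ≤ ι) (hP : 0 ≤ P) (hPR : P < R)
    (hD : 0 ≤ D) (hlo : 0 ≤ lo) (hDlo : D ≤ R * lo) (h1 : lo ≤ γ) (h2 : γ ≤ hi) :
    R * cheapestShare ι R P D lo hi + ι * leastInspection R P D (cheapestShare ι R P D lo hi) ≤
      R * γ + ι * leastInspection R P D γ := by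
  have hR : 0 < R := hP.trans_lt hPR
  have hRP : 0 < R - P := sub_pos.2 hPR
  set m := cheapestShare ι R P D lo hi with hm
  set s := √(ι * D / (R * P)) with hs
  set z := D / (R - P) with hz
  have hmlo : lo ≤ m := le_max_left _ _
  have hs0 : 0 ≤ s := Real.sqrt_nonneg _
  have hγ0 : 0 ≤ γ := hlo.trans h1
  have hm0 : 0 ≤ m := hlo.trans hmlo
  have hβ0 := mul_nonneg hι (leastInspection_nonneg R P D γ)
  -- at and beyond `z` no inspection is needed
  have hzero : z ≤ m → leastInspection R P D m = 0 := fun h => by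
    refine max_eq_left (div_nonpos_of_nonpos_of_nonneg ?_ (mul_nonneg hP hm0))
    rw [hz, div_le_iff₀ hRP] at h
    linarith
  rcases hP.eq_or_lt with hP0 | hP0
  -- `P = 0`: no inspection is ever needed, and the square root is `0`
  · have hs' : s = 0 := by rw [hs, ← hP0]; simp
    have hz0 : 0 ≤ z := div_nonneg hD hRP.le
    have : m = lo := by
      rw [hm, cheapestShare, ← hs, ← hz, hs', min_eq_left hz0,
        min_eq_right (hγ0.trans h2), max_eq_left hlo]
    have h3 : leastInspection R P D m = 0 := by simp [leastInspection, ← hP0]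
    rw [h3, this]
    nlinarith
  have hRP' : 0 < R * P := mul_pos hR hP0
  have hss : s ^ 2 * (R * P) = ι * D := by
    rw [hs, Real.sq_sqrt (div_nonneg (mul_nonneg hι hD) hRP'.le), div_mul_cancel₀ _ hRP'.ne']
  -- the cost where inspection is needed, compared at two points
  have hcmp : ∀ x y : ℝ, 0 < x → 0 < y → 0 ≤ (y - x) * (R * P * (x * y) - ι * D) →
      R * x + ι * ((D - (R - P) * x) / (P * x)) ≤ R * y + ι * ((D - (R - P) * y) / (P * y)) := by
    intro x y hx hy h
    have : R * y + ι * ((D - (R - P) * y) / (P * y)) - (R * x + ι * ((D - (R - P) * x) / (P * x)))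
        = (y - x) * (R * P * (x * y) - ι * D) / (P * x * y) := by
      field_simp
      ring
    have h' := div_nonneg h (by positivity : 0 ≤ P * x * y)
    linarith
  have hγβ : ι * ((D - (R - P) * γ) / (P * γ)) ≤ ι * leastInspection R P D γ :=
    mul_le_mul_of_nonneg_left (le_max_right _ _) hι
  have hneed : 0 < m → m ≤ z → leastInspection R P D m = (D - (R - P) * m) / (P * m) :=
      fun h h' => by
    refine max_eq_right (div_nonneg ?_ (by positivity))
    rw [hz, le_div_iff₀ hRP] at h'
    linarith
  rcases lt_trichotomy γ m with hlt | heq | hgt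
  -- left of the optimum
  · have h3 : m ≤ min hi (min s z) := by
      rcases max_choice lo (min hi (min s z)) with h | h
      · rw [hm, cheapestShare, h] at hlt
        linarith
      · exact (show m = _ from h).le
    have h4 : m ≤ s := h3.trans ((min_le_right _ _).trans (min_le_left _ _))
    have h5 : m ≤ z := h3.trans ((min_le_right _ _).trans (min_le_right _ _))
    have hmpos : 0 < m := hγ0.trans_lt hlt
    have hγpos : 0 < γ := by
      refine hγ0.lt_of_ne fun h => ?_
      have hlo0 : lo = 0 := by linarith
      rw [hlo0, mul_zero] at hDlo
      have : z = 0 := by rw [hz, le_antisymm hDlo hD, zero_div]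
      linarith
    rw [hneed hmpos h5]
    have h6 : m * γ ≤ s ^ 2 := by nlinarith
    have h7 := mul_le_mul_of_nonneg_right h6 hRP'.le
    have := hcmp m γ hmpos hγpos (mul_nonneg_of_nonpos_of_nonpos (by linarith) (by linarith))
    linarith
  · rw [heq]
  -- right of the optimum
  · have h3 : min s z ≤ m := by
      have h : min hi (min s z) ≤ m := le_max_right _ _
      rcases min_le_iff.1 h with h | h
      · linarith
      · exact h
    by_cases hzm : z ≤ m
    · rw [hzero hzm]
      nlinarith
    · have hsm : s ≤ m := (min_le_iff.1 h3).resolve_right hzm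
      have hmpos : 0 < m := by
        refine hm0.lt_of_ne fun h => hzm ?_
        have hlo0 : lo = 0 := by linarith
        rw [hlo0, mul_zero] at hDlo
        rw [hz, le_antisymm hDlo hD, zero_div]
        exact hm0
      rw [hneed hmpos (not_le.1 hzm).le]
      have h6 : s ^ 2 ≤ m * γ := by nlinarith
      have h7 := mul_le_mul_of_nonneg_right h6 hRP'.le
      have := hcmp m γ hmpos (hmpos.trans hgt) (mul_nonneg (by linarith) (by linarith))
      linarith

/-- The contract `(γ, β)` makes the safe action with line `k` of the envelope optimal for the
agent: line `k` is the highest one at `γ`, and by at least the cost `κ` of safety higher than all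
lines are at `(1 - β) * (1 - α) * γ`, in particular than the zero line. -/
structure EnvelopeContract (κ α : ℝ) (m : ℕ) (r c b : ℕ → ℝ) (k : ℕ) (γ β : ℝ) : Prop where
  one_le : 1 ≤ k
  lt : k < m
  share_nonneg : 0 ≤ γ
  share_le_one : γ ≤ 1
  inspection_nonneg : 0 ≤ β
  inspection_le_one : β ≤ 1
  meet_le : b k ≤ γ
  le_meet : γ ≤ b (k + 1)
  deters : ∀ j < m, r j * ((1 - β) * (1 - α) * γ) - c j ≤ r k * γ - c k - κ

/-- The point where line `i` minus the cost of safety reaches the height of line `j` at `x`. -/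
noncomputable def levelPoint (κ : ℝ) (r c : ℕ → ℝ) (i j : ℕ) (x : ℝ) : ℝ :=
  (r j * x - c j + κ + c i) / r i

/-- The left end of the interval of the shares `γ` at which line `i` is the highest one and at
which line `j` is the highest one where it reaches the height of line `i` minus the cost of
safety. -/
noncomputable def pairLow (κ : ℝ) (r c b : ℕ → ℝ) (i j : ℕ) : ℝ :=
  max (b i) (levelPoint κ r c i j (b j))

/-- The right end of the interval that begins at `pairLow`, cut off at `1`. -/
noncomputable def pairHigh (κ : ℝ) (r c b : ℕ → ℝ) (i j : ℕ) : ℝ :=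
  min 1 (min (b (i + 1)) (levelPoint κ r c i j (b (j + 1))))

/-- The best share for the lines `i` and `j`. -/
noncomputable def pairShare (κ ι α : ℝ) (r c b : ℕ → ℝ) (i j : ℕ) : ℝ :=
  cheapestShare ι (r i) (r j * (1 - α)) (c i + κ - c j) (pairLow κ r c b i j) (pairHigh κ r c b i j)

/-- The best inspection probability for the lines `i` and `j`. -/
noncomputable def pairInspection (κ ι α : ℝ) (r c b : ℕ → ℝ) (i j : ℕ) : ℝ :=
  leastInspection (r i) (r j * (1 - α)) (c i + κ - c j) (pairShare κ ι α r c b i j)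

namespace Envelope

variable {m : ℕ} {r c b : ℕ → ℝ} {κ ι α : ℝ} {i j : ℕ}

theorem le_levelPoint_iff (h : Envelope m r c b) (hi : 1 ≤ i) (him : i < m) {γ x : ℝ} :
    γ ≤ levelPoint κ r c i j x ↔ r i * γ - c i - κ ≤ r j * x - c j := by
  rw [levelPoint, le_div_iff₀ (h.slope_pos hi him), mul_comm γ]
  constructor <;> intro h <;> linarith

theorem levelPoint_le_iff (h : Envelope m r c b) (hi : 1 ≤ i) (him : i < m) {γ x : ℝ} :
    levelPoint κ r c i j x ≤ γ ↔ r j * x - c j ≤ r i * γ - c i - κ := by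
  rw [levelPoint, div_le_iff₀ (h.slope_pos hi him), mul_comm γ]
  constructor <;> intro h <;> linarith

theorem pairLow_nonneg (h : Envelope m r c b) (him : i < m) : 0 ≤ pairLow κ r c b i j :=
  (h.meet_nonneg i him).trans (le_max_left _ _)

theorem demand_le (h : Envelope m r c b) (hi : 1 ≤ i) (him : i < m) (hj : j < m) :
    c i + κ - c j ≤ r i * pairLow κ r c b i j := by
  have h1 := (h.levelPoint_le_iff hi him).1
    (le_max_right (b i) (levelPoint κ r c i j (b j)))
  have h2 := mul_nonneg (h.slope_zero ▸ h.slope_mono (Nat.zero_le j) hj) (h.meet_nonneg j hj)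
  unfold pairLow
  linarith

theorem envelopeContract_pair (h : Envelope m r c b) (hα1 : α ≤ 1)
    (hj : 1 ≤ j) (hji : j ≤ i) (him : i < m)
    (hle : pairLow κ r c b i j ≤ pairHigh κ r c b i j) :
    EnvelopeContract κ α m r c b i (pairShare κ ι α r c b i j)
      (pairInspection κ ι α r c b i j) := by
  have hjm : j < m := by omega
  have hi : 1 ≤ i := by omega
  set γ := pairShare κ ι α r c b i j with hγ
  have hlo : pairLow κ r c b i j ≤ γ := le_max_left _ _
  have hhi : γ ≤ pairHigh κ r c b i j := max_le hle (min_le_left _ _)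
  have hγ0 : 0 ≤ γ := (h.pairLow_nonneg him).trans hlo
  have hP : 0 ≤ r j * (1 - α) := mul_nonneg (h.slope_pos hj hjm).le (by linarith)
  have hD : c i + κ - c j ≤ r i * γ :=
    (h.demand_le hi him hjm).trans (mul_le_mul_of_nonneg_left hlo (h.slope_pos hi him).le)
  have hβ0 : 0 ≤ pairInspection κ ι α r c b i j := leastInspection_nonneg _ _ _ _
  have h1 : r j * b j - c j ≤ r i * γ - c i - κ :=
    (h.levelPoint_le_iff hi him).1 ((le_max_right _ _).trans hlo)
  have h2 : r i * γ - c i - κ ≤ r j * b (j + 1) - c j :=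
    (h.le_levelPoint_iff hi him).1 (hhi.trans ((min_le_right _ _).trans (min_le_right _ _)))
  have h3 := (leastInspection_le_iff hP hγ0 hD hβ0).1 le_rfl
  refine ⟨hi, him, hγ0, hhi.trans (min_le_left _ _), hβ0, ?_, (le_max_left _ _).trans hlo,
    hhi.trans ((min_le_right _ _).trans (min_le_left _ _)), fun j' hj' => ?_⟩
  · exact (leastInspection_le_iff hP hγ0 hD zero_le_one).2 (by linarith)
  -- compare with the point `X` where line `j`, the highest one there, reaches the required height
  · have hrj := h.slope_pos hj hjm
    obtain ⟨X, hX⟩ : ∃ X, r j * X - c j = r i * γ - c i - κ :=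
      ⟨(r i * γ - c i - κ + c j) / r j, by field_simp; ring⟩
    have h4 : b j ≤ X := le_of_mul_le_mul_left (by linarith) hrj
    have h5 : X ≤ b (j + 1) := le_of_mul_le_mul_left (by linarith) hrj
    have h6 : (1 - pairInspection κ ι α r c b i j) * (1 - α) * γ ≤ X := by
      refine le_of_mul_le_mul_left ?_ hrj
      have h7 : (1 - pairInspection κ ι α r c b i j) * (r j * (1 - α)) * γ ≤
        r i * γ - (c i + κ - c j) := h3
      linarith
    have h7 := h.le_line hj' hjm h4 h5
    have h8 := mul_le_mul_of_nonneg_left h6 (h.slope_zero ▸ h.slope_mono (Nat.zero_le j') hj')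
    linarith

/-- Among the contracts whose share lies in the interval of the lines `i` and `j`, the one given by
`pairShare` and `pairInspection` is the best. -/
theorem utility_le_pair (h : Envelope m r c b) (hκ : 0 ≤ κ) (hι : 0 ≤ ι) (hα0 : 0 < α)
    (hα1 : α ≤ 1) (hj : 1 ≤ j) (hji : j ≤ i) {γ β : ℝ}
    (hC : EnvelopeContract κ α m r c b i γ β)
    (h1 : r j * b j - c j ≤ r i * γ - c i - κ) (h2 : r i * γ - c i - κ ≤ r j * b (j + 1) - c j) :
    pairLow κ r c b i j ≤ pairHigh κ r c b i j ∧
      (1 - γ) * r i - β * ι ≤ (1 - pairShare κ ι α r c b i j) * r i -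
        pairInspection κ ι α r c b i j * ι := by
  have him := hC.lt
  have hi := hC.one_le
  have hjm : j < m := by omega
  have hrj := h.slope_pos hj hjm
  have hlo : pairLow κ r c b i j ≤ γ := max_le hC.meet_le ((h.levelPoint_le_iff hi him).2 h1)
  have hhi : γ ≤ pairHigh κ r c b i j :=
    le_min hC.share_le_one (le_min hC.le_meet ((h.le_levelPoint_iff hi him).2 h2))
  have hP : 0 ≤ r j * (1 - α) := mul_nonneg hrj.le (by linarith)
  have hPR : r j * (1 - α) < r i := by
    have := h.slope_mono hji him
    nlinarith
  have hD := h.demand_le (κ := κ) hi him hjm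
  have hDγ := hD.trans (mul_le_mul_of_nonneg_left hlo (h.slope_pos hi him).le)
  have h3 : leastInspection (r i) (r j * (1 - α)) (c i + κ - c j) γ ≤ β := by
    refine (leastInspection_le_iff hP hC.share_nonneg hDγ hC.inspection_nonneg).2 ?_
    have := hC.deters j hjm
    linarith
  have h4 := cheapestShare_spec hι hP hPR (by linarith [h.cost_mono hji him])
    (h.pairLow_nonneg him) hD hlo hhi
  have h5 := mul_le_mul_of_nonneg_left h3 hι
  refine ⟨hlo.trans hhi, ?_⟩
  unfold pairInspection pairShare
  linarith

end Envelope

/-! ### Sweeping over the pairs of lines -/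

/-- For the lines `i` and `j` (variables `5` and `6`), compute the ends of their interval (variables
`10` and `12`), the best share, the best inspection probability and the resulting utility of the
principal (variables `13`, `14`, `15`). Variable `11` gets the right end without the two cut-offs;
`16` and `17` hold the numbers `D` and `P` of `leastInspection`. -/
def computePair : Program :=
  .block [
    .letReal 10 (.max (.cell 9 (.var 5)) (.div (.add (.add (.sub (.mul (.cell 7 (.var 6))
      (.cell 9 (.var 6))) (.cell 8 (.var 6))) (.var 2)) (.cell 8 (.var 5))) (.cell 7 (.var 5)))),
    .letReal 11 (.div (.add (.add (.sub (.mul (.cell 7 (.var 6))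
      (.cell 9 (.add (.var 6) (.lit 1)))) (.cell 8 (.var 6))) (.var 2)) (.cell 8 (.var 5)))
      (.cell 7 (.var 5))),
    .letReal 12 (.min (.lit 1) (.min (.cell 9 (.add (.var 5) (.lit 1))) (.var 11))),
    .letReal 16 (.sub (.add (.cell 8 (.var 5)) (.var 2)) (.cell 8 (.var 6))),
    .letReal 17 (.mul (.cell 7 (.var 6)) (.sub (.lit 1) (.cell 2 (.lit 2)))),
    .letReal 13 (.max (.var 10) (.min (.var 12) (.min
      (.sqrt (.div (.mul (.cell 2 (.lit 1)) (.var 16)) (.mul (.cell 7 (.var 5)) (.var 17))))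
      (.div (.var 16) (.sub (.cell 7 (.var 5)) (.var 17)))))),
    .letReal 14 (.max (.lit 0) (.div (.sub (.var 16)
      (.mul (.sub (.cell 7 (.var 5)) (.var 17)) (.var 13))) (.mul (.var 17) (.var 13)))),
    .letReal 15 (.sub (.mul (.sub (.lit 1) (.var 13)) (.cell 7 (.var 5)))
      (.mul (.var 14) (.cell 2 (.lit 1))))]

/-- The utility of the principal from the best contract for the lines `i` and `j`. -/
noncomputable def pairUtility (κ ι α : ℝ) (r c b : ℕ → ℝ) (i j : ℕ) : ℝ :=
  (1 - pairShare κ ι α r c b i j) * r i - pairInspection κ ι α r c b i j * ι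

theorem wp_computePair {σ : Store} {κ ι α : ℝ} {r c b : ℕ → ℝ} {i j : ℕ}
    (hκ : σ.real 2 0 = κ) (hι : σ.real 2 1 = ι) (hα : σ.real 2 2 = α) (hr : σ.real 7 = r)
    (hc : σ.real 8 = c) (hb : σ.real 9 = b) (hi : σ.nat 5 0 = i) (hj : σ.nat 6 0 = j) :
    computePair.wp (fun τ => τ.nat = σ.nat ∧ (∀ a < 10, τ.real a = σ.real a) ∧
      τ.real 10 0 = pairLow κ r c b i j ∧ τ.real 11 0 = levelPoint κ r c i j (b (j + 1)) ∧
      τ.real 12 0 = pairHigh κ r c b i j ∧ τ.real 13 0 = pairShare κ ι α r c b i j ∧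
      τ.real 14 0 = pairInspection κ ι α r c b i j ∧
      τ.real 15 0 = pairUtility κ ι α r c b i j) σ := by
  subst hκ hι hα hr hc hb hi hj
  simp only [computePair, Program.block, Program.wp, NatExpr.eval, RealExpr.eval,
    RealExpr.eval_max, RealExpr.eval_min, Store.nat_setReal, Store.real_setReal]
  simp only [Nat.reduceEqDiff, if_true, if_false, Function.update_self, Nat.cast_one,
    Nat.cast_zero]
  refine ⟨trivial, fun a ha => ?_, rfl, rfl, rfl, rfl, rfl, rfl⟩
  simp [show a ≠ 10 by omega, show a ≠ 11 by omega, show a ≠ 12 by omega, show a ≠ 13 by omega,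
    show a ≠ 14 by omega, show a ≠ 15 by omega, show a ≠ 16 by omega, show a ≠ 17 by omega]

/-- Store the contract of the present pair in the output array `3`, if its interval is non-empty and
it is better than the best contract so far. -/
def keepBetter : Program :=
  .branch (.conj (.realLe (.var 10) (.var 12))
      (.neg (.realLe (.var 15) (.cell 3 (.lit 2)))))
    (.block [.setReal 3 (.lit 0) (.var 13), .setReal 3 (.lit 1) (.var 14),
      .setReal 3 (.lit 2) (.var 15)]) .skip

/-- Go on to the next pair: increase `i` or `j`, according to which of the two right ends comes
first. -/
def advance : Program :=
  .branch (.realLe (.cell 9 (.add (.var 5) (.lit 1))) (.var 11))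
    (.letNat 5 (.add (.var 5) (.lit 1))) (.letNat 6 (.add (.var 6) (.lit 1)))

/-- Go through the pairs of lines in the order of increasing shares and find the best contract. The
initial value is the contract `(1, 1)`, which gives the principal the utility `-κ_I`. -/
def sweep : Program :=
  .block [.setReal 3 (.lit 0) (.lit 1), .setReal 3 (.lit 1) (.lit 1),
    .setReal 3 (.lit 2) (.sub (.lit 0) (.cell 2 (.lit 1))), .letNat 5 (.lit 1),
    .letNat 6 (.lit 1), .loop (.natLt (.var 5) (.var 4))
      (.block [computePair, keepBetter, advance])]

/-- All contracts have been taken into account by the value `u` except those that belong to pairs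
from `(i, j)` on. -/
def Covered (κ ι α : ℝ) (m : ℕ) (r c b : ℕ → ℝ) (i j : ℕ) (u : ℝ) : Prop :=
  ∀ k γ β, EnvelopeContract κ α m r c b k γ β → (1 - γ) * r k - β * ι ≤ u ∨
    (i ≤ k ∧ r j * b j - c j ≤ r k * γ - c k - κ)

namespace Envelope

variable {m : ℕ} {r c b : ℕ → ℝ} {κ ι α : ℝ} {i j : ℕ} {u : ℝ}

theorem covered_one (h : Envelope m r c b) : Covered κ ι α m r c b 1 1 u := fun k γ β hC => by
  have h1 := hC.one_le
  have h2 := hC.lt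
  have h3 := h.meet 0 (by omega)
  have h4 := hC.deters 0 (by omega)
  rw [h.slope_zero, h.cost_zero] at h3 h4
  exact .inr ⟨hC.one_le, by linarith⟩

/-- If line `i` ends before line `j` is left, then all contracts for line `i` have been taken into
account. -/
theorem covered_left (h : Envelope m r c b) (hκ : 0 ≤ κ) (hι : 0 ≤ ι) (hα0 : 0 < α)
    (hα1 : α ≤ 1) (hj : 1 ≤ j) (hji : j ≤ i) (hc : Covered κ ι α m r c b i j u)
    (hu : pairLow κ r c b i j ≤ pairHigh κ r c b i j → pairUtility κ ι α r c b i j ≤ u)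
    (hle : b (i + 1) ≤ levelPoint κ r c i j (b (j + 1))) :
    Covered κ ι α m r c b (i + 1) j u := fun k γ β hC => by
  rcases hc k γ β hC with h1 | ⟨h1, h2⟩
  · exact .inl h1
  rcases h1.eq_or_lt with rfl | h1
  · left
    have h3 := (h.le_levelPoint_iff hC.one_le hC.lt).1 (hC.le_meet.trans hle)
    obtain ⟨h4, h5⟩ := h.utility_le_pair hκ hι hα0 hα1 hj hji hC h2 h3
    exact h5.trans (hu h4)
  · exact .inr ⟨h1, h2⟩

/-- If line `j` is left before line `i` ends, then all contracts for which line `j` is the critical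
one have been taken into account. -/
theorem covered_right (h : Envelope m r c b) (hκ : 0 ≤ κ) (hι : 0 ≤ ι)
    (hα0 : 0 < α) (hα1 : α ≤ 1) (hj : 1 ≤ j) (hji : j ≤ i) (him : i < m)
    (hc : Covered κ ι α m r c b i j u)
    (hu : pairLow κ r c b i j ≤ pairHigh κ r c b i j → pairUtility κ ι α r c b i j ≤ u)
    (hlt : levelPoint κ r c i j (b (j + 1)) < b (i + 1)) :
    j < i ∧ Covered κ ι α m r c b i (j + 1) u := by
  have hlt' : j < i := by
    refine hji.lt_of_ne fun h1 => hlt.not_ge ?_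
    subst h1
    exact (h.le_levelPoint_iff hj him).2 (by linarith)
  refine ⟨hlt', fun k γ β hC => ?_⟩
  rcases hc k γ β hC with h1 | ⟨h1, h2⟩
  · exact .inl h1
  have h3 := h.meet j (by omega)
  rcases le_or_gt (r (j + 1) * b (j + 1) - c (j + 1)) (r k * γ - c k - κ) with h4 | h4
  · exact .inr ⟨h1, h4⟩
  left
  rcases h1.eq_or_lt with rfl | h1
  · obtain ⟨h5, h6⟩ := h.utility_le_pair hκ hι hα0 hα1 hj hji hC h2 (by linarith)
    exact h6.trans (hu h5)
  -- from `b (i + 1)` on, line `i` minus `κ` is higher than line `j + 1` is at `b (j + 1)`, so line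
  -- `k` minus `κ` is higher than that at `γ`
  · exfalso
    have h5 : b (i + 1) ≤ γ := (h.meet_mono (by omega) h1 hC.lt).trans hC.meet_le
    have h6 := (not_le.1 fun h6 => hlt.not_ge ((h.le_levelPoint_iff (by omega) him).2 h6))
    have h7 := mul_le_mul_of_nonneg_left h5 (h.slope_pos (by omega) him).le
    have h8 := h.le_line him hC.lt hC.meet_le hC.le_meet
    linarith

end Envelope

theorem halts_sweep {n m : ℕ} {R p r c b : ℕ → ℝ} {σ : Store} {G : ℝ → ℝ → ℝ → Prop}
    (hk : Keeps n R p σ) (hm : σ.nat 4 0 = m) (hr : σ.real 7 = r) (hc : σ.real 8 = c)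
    (hb : σ.real 9 = b) (h : Envelope m r c b) (hκ : 0 ≤ p 0)
    (hι : 0 ≤ p 1) (hα0 : 0 < p 2) (hα1 : p 2 ≤ 1) (hG : G 1 1 (-p 1))
    (hGC : ∀ k γ β, EnvelopeContract (p 0) (p 2) m r c b k γ β →
      G γ β ((1 - γ) * r k - β * p 1)) :
    Halts sweep σ (2 * m + 1) (fun σ' => ∃ u, G (σ'.real 3 0) (σ'.real 3 1) u ∧
      ∀ k γ β, EnvelopeContract (p 0) (p 2) m r c b k γ β → (1 - γ) * r k - β * p 1 ≤ u) := by
  refine Halts.seq_wp (by omega) <| Halts.seq_wp (by omega) <| Halts.seq_wp (by omega) <|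
    Halts.seq_wp (by omega) <| Halts.seq_wp (by omega) ?_
  refine (Halts.loop_wp (fun τ => (τ.nat 4 0 = m ∧ τ.real 2 = p ∧ τ.real 7 = r ∧ τ.real 8 = c ∧
      τ.real 9 = b) ∧ (1 ≤ τ.nat 6 0 ∧ τ.nat 6 0 ≤ τ.nat 5 0 ∧ τ.nat 5 0 ≤ m) ∧
      G (τ.real 3 0) (τ.real 3 1) (τ.real 3 2) ∧
      Covered (p 0) (p 1) (p 2) m r c b (τ.nat 5 0) (τ.nat 6 0) (τ.real 3 2))
    (fun τ => 2 * m - τ.nat 5 0 - τ.nat 6 0) ?_ ?_ (by omega)).mono le_rfl ?_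
  · rintro τ ⟨⟨h1, h2, h3, h4, h5⟩, ⟨h6, h7, h8⟩, h9, h10⟩ h11
    simp only [Test.Holds, NatExpr.eval, h1] at h11
    change computePair.wp (keepBetter.wp (advance.wp _)) τ
    refine Program.wp_mono ?_ (wp_computePair (κ := p 0) (ι := p 1) (α := p 2) (by rw [h2])
      (by rw [h2]) (by rw [h2]) h3 h4 h5 rfl rfl)
    rintro υ ⟨k0, k1, k2, k3, k4, k5, k6, k7⟩
    set i := τ.nat 5 0 with hi
    set j := τ.nat 6 0 with hj
    have e3 := k1 3 (by omega)
    -- the best contract is brought up to date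
    have hkeep : keepBetter.wp (fun ω => ω.nat = τ.nat ∧ (∀ a, a < 10 → a ≠ 3 →
        ω.real a = τ.real a) ∧ ω.real 11 = υ.real 11 ∧
        G (ω.real 3 0) (ω.real 3 1) (ω.real 3 2) ∧ τ.real 3 2 ≤ ω.real 3 2 ∧
        (pairLow (p 0) r c b i j ≤ pairHigh (p 0) r c b i j →
          pairUtility (p 0) (p 1) (p 2) r c b i j ≤ ω.real 3 2)) υ := by
      refine ⟨fun h12 => ?_, fun h12 => ?_⟩
      · simp only [Test.Holds, RealExpr.eval, NatExpr.eval, k2, k4, k7, e3, not_le] at h12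
        simp only [Program.block, Program.wp, NatExpr.eval, RealExpr.eval, Store.nat_setReal,
          Store.real_setReal]
        simp only [if_true, if_false, Nat.reduceEqDiff, Function.update_self, ne_eq,
          not_false_eq_true, Function.update_of_ne, OfNat.zero_ne_ofNat, OfNat.one_ne_ofNat,
          zero_ne_one, k5, k6, k7]
        refine ⟨k0, fun a ha ha' => by simp [ha', k1 a ha], trivial, ?_, h12.2.le,
          fun _ => le_rfl⟩
        exact hGC _ _ _ (h.envelopeContract_pair hα1 h6 h7 h11 h12.1)
      · simp only [Test.Holds, RealExpr.eval, NatExpr.eval, k2, k4, k7, e3, not_and, not_not] at h12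
        refine ⟨k0, fun a ha _ => k1 a ha, rfl, ?_, ?_, ?_⟩
        · rwa [e3]
        · rw [e3]
        · rw [e3]; exact h12
    refine Program.wp_mono ?_ hkeep
    rintro ω ⟨l0, l1, l2, l3, l4, l5⟩
    have e9 : ω.real 9 = b := by rw [l1 9 (by omega) (by omega), h5]
    have hcov : Covered (p 0) (p 1) (p 2) m r c b i j (ω.real 3 2) := fun k γ β hC =>
      (h10 k γ β hC).imp_left fun h' => h'.trans l4
    refine ⟨fun h12 => ?_, fun h12 => ?_⟩
    · simp only [Test.Holds, RealExpr.eval, NatExpr.eval, e9, l0, l2, k3, ← hi] at h12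
      have hcov' := h.covered_left hκ hι hα0 hα1 h6 h7 hcov l5 h12
      simp only [Program.wp, NatExpr.eval, Store.nat_setNat, Store.real_setNat, l0, e9]
      simp only [if_true, if_false, Nat.reduceEqDiff, Function.update_self, ← hi, ← hj]
      refine ⟨⟨⟨h1, ?_, ?_, ?_, trivial⟩, ⟨h6, by omega, by omega⟩, l3, hcov'⟩, by omega⟩
      · rw [l1 2 (by omega) (by omega), h2]
      · rw [l1 7 (by omega) (by omega), h3]
      · rw [l1 8 (by omega) (by omega), h4]
    · simp only [Test.Holds, RealExpr.eval, NatExpr.eval, e9, l0, l2, k3, ← hi, not_le] at h12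
      obtain ⟨hji, hcov'⟩ := h.covered_right hκ hι hα0 hα1 h6 h7 h11 hcov l5 h12
      simp only [Program.wp, NatExpr.eval, Store.nat_setNat, Store.real_setNat, l0, e9]
      simp only [if_true, if_false, Nat.reduceEqDiff, Function.update_self, ← hi, ← hj]
      refine ⟨⟨⟨h1, ?_, ?_, ?_, trivial⟩, ⟨by omega, by omega, by omega⟩, l3, hcov'⟩, by omega⟩
      · rw [l1 2 (by omega) (by omega), h2]
      · rw [l1 7 (by omega) (by omega), h3]
      · rw [l1 8 (by omega) (by omega), h4]
  · simp [NatExpr.eval, RealExpr.eval, hm, hr, hc, hb, hk.2.2]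
    exact ⟨h.pos, hG, h.covered_one⟩
  · rintro τ ⟨⟨⟨h1, -⟩, ⟨h2, h3, h4⟩, h5, h6⟩, h7⟩
    simp only [Test.Holds, NatExpr.eval, h1] at h7
    refine ⟨_, h5, fun k γ β hC => (h6 k γ β hC).resolve_right fun h8 => ?_⟩
    have := hC.lt
    omega

end RealRAM

/-! ### Linear contracts and the envelope -/

namespace SafetyAgent

open RealRAM

variable {n : ℕ} (A : SafetyAgent n)

theorem expectedPayment_linearContract (γ β : ℝ) (i : Fin n) :
    A.expectedPayment (linearContract γ β) i = γ * A.expectedReward i := by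
  simp only [expectedPayment, linearContract, expectedReward]
  exact integral_const_mul _ _

theorem expectedReward_nonneg (i : Fin n) : 0 ≤ A.expectedReward i :=
  integral_nonneg_of_ae (A.rewardLaw_nonneg i)

theorem implements_linearContract_iff {γ β : ℝ} {i : Fin n} :
    A.Implements (linearContract γ β) i true ↔
      (∀ i', A.expectedReward i' * γ - A.cost i' ≤ A.expectedReward i * γ - A.cost i) ∧
      (∀ i', A.expectedReward i' * ((1 - β) * (1 - A.sideEffectProb) * γ) - A.cost i' ≤
        A.expectedReward i * γ - A.cost i - A.safetyCost) ∧
      0 ≤ A.expectedReward i * γ - A.cost i - A.safetyCost := by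
  simp only [Implements, Bool.forall_bool, agentUtility, expectedPayment_linearContract,
    forall_and, mul_comm γ]
  have h1 : ∀ i', (A.expectedReward i' * γ - A.cost i' - A.safetyCost ≤
      A.expectedReward i * γ - A.cost i - A.safetyCost) ↔
      A.expectedReward i' * γ - A.cost i' ≤ A.expectedReward i * γ - A.cost i := fun i' => by
    constructor <;> intro h <;> linarith
  have h2 : ∀ i', (1 - (linearContract γ β).inspection) * (1 - A.sideEffectProb) *
      (A.expectedReward i' * γ) =
      A.expectedReward i' * ((1 - β) * (1 - A.sideEffectProb) * γ) := fun i' => by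
    simp only [linearContract]; ring
  simp only [h1, h2]
  tauto

/-- The lines `x ↦ r k * x - c k`, `1 ≤ k < m`, belong to actions, and no action is anywhere above
the envelope of these lines and the zero line. Line `m - 1` is the highest one up to `b m > 1`. -/
structure HasEnvelope (m : ℕ) (r c b : ℕ → ℝ) : Prop where
  env : Envelope m r c b
  last : 1 < b m
  among : ∀ k, 1 ≤ k → k < m → ∃ i, r k = A.expectedReward i ∧ c k = A.cost i
  cover : ∀ (i : Fin n) (x : ℝ), ∃ k < m, A.expectedReward i * x - A.cost i ≤ r k * x - c k

variable {A} {m : ℕ} {r c b : ℕ → ℝ}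

namespace HasEnvelope

theorem le_line (h : A.HasEnvelope m r c b) {k : ℕ} {x : ℝ} (hk : k < m) (hx : b k ≤ x)
    (hx' : x ≤ b (k + 1)) (i : Fin n) :
    A.expectedReward i * x - A.cost i ≤ r k * x - c k := by
  obtain ⟨j, hj, h1⟩ := h.cover i x
  exact h1.trans (h.env.le_line hj hk hx hx')

theorem implements (h : A.HasEnvelope m r c b) {k : ℕ} {γ β : ℝ}
    (hC : EnvelopeContract A.safetyCost A.sideEffectProb m r c b k γ β) :
    ∃ i, A.expectedReward i = r k ∧ A.Implements (linearContract γ β) i true := by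
  obtain ⟨i, h1, h2⟩ := h.among k hC.one_le hC.lt
  refine ⟨i, h1.symm, A.implements_linearContract_iff.2 ?_⟩
  rw [← h1, ← h2]
  refine ⟨h.le_line hC.lt hC.meet_le hC.le_meet, fun i' => ?_, ?_⟩
  · obtain ⟨j, hj, h3⟩ := h.cover i' ((1 - β) * (1 - A.sideEffectProb) * γ)
    exact h3.trans (hC.deters j hj)
  · have := hC.deters 0 h.env.pos
    rwa [h.env.slope_zero, h.env.cost_zero, zero_mul, sub_zero] at this

/-- Where a profitable action exists, a line other than the zero line is the highest one. -/
theorem exists_line (h : A.HasEnvelope m r c b) {γ : ℝ} (hγ : γ ≤ 1) {i : Fin n}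
    (hR : 0 < A.expectedReward i) (hi : 0 ≤ A.expectedReward i * γ - A.cost i) :
    ∃ k, 1 ≤ k ∧ k < m ∧ b k ≤ γ ∧ γ < b (k + 1) := by
  have h1 : 1 < m ∧ b 1 ≤ γ := by
    by_contra! h1
    -- otherwise the zero line would be the highest one even to the right of `γ`
    obtain ⟨x, hx, hx'⟩ : ∃ x, γ < x ∧ (1 < m → x ≤ b 1) := by
      by_cases hm : 1 < m
      · exact ⟨b 1, h1 hm, fun _ => le_rfl⟩
      · exact ⟨γ + 1, by linarith, fun h => absurd h hm⟩
    obtain ⟨k, hk, h2⟩ := h.cover i x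
    have h3 : r k * x - c k ≤ r 0 * x - c 0 := by
      rcases Nat.eq_zero_or_pos k with rfl | hk0
      · exact le_rfl
      · exact h.env.le_of_le_meet (Nat.zero_le k) hk (hx' (by omega))
    rw [h.env.slope_zero, h.env.cost_zero] at h3
    nlinarith
  have h2 : b (Nat.findGreatest (fun k => b k ≤ γ) (m - 1)) ≤ γ :=
    Nat.findGreatest_spec (P := fun k => b k ≤ γ) (by omega : 1 ≤ m - 1) h1.2
  have h3 := Nat.le_findGreatest (P := fun k => b k ≤ γ) (by omega : 1 ≤ m - 1) h1.2
  have h4 := Nat.findGreatest_le (P := fun k => b k ≤ γ) (m - 1)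
  refine ⟨_, h3, by omega, h2, ?_⟩
  by_contra! h5
  rcases h4.eq_or_lt with h6 | h6
  · rw [h6, show m - 1 + 1 = m by omega] at h5
    linarith [h.last]
  · exact Nat.findGreatest_is_greatest (Nat.lt_succ_self _) h6 h5

/-- A contract that implements a safe action with a positive reward also implements one on the
envelope, which is at least as good for the principal. -/
theorem exists_envelopeContract (h : A.HasEnvelope m r c b) {γ β : ℝ}
    (hγ : γ ∈ Set.Icc (0 : ℝ) 1) (hβ : β ∈ Set.Icc (0 : ℝ) 1) {i : Fin n}
    (hR : 0 < A.expectedReward i) (hI : A.Implements (linearContract γ β) i true) :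
    ∃ k, EnvelopeContract A.safetyCost A.sideEffectProb m r c b k γ β ∧
      A.expectedReward i ≤ r k := by
  obtain ⟨h1, h2, h3⟩ := A.implements_linearContract_iff.1 hI
  obtain ⟨k, hk1, hkm, h4, h5⟩ := h.exists_line hγ.2 hR (by linarith [A.safetyCost_nonneg])
  have h6 := h.le_line hkm h4 h5.le i
  refine ⟨k, ⟨hk1, hkm, hγ.1, hγ.2, hβ.1, hβ.2, h4, h5.le, fun j hj => ?_⟩, ?_⟩
  · rcases Nat.eq_zero_or_pos j with rfl | hj0
    · rw [h.env.slope_zero, h.env.cost_zero]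
      linarith
    · obtain ⟨i', h7, h8⟩ := h.among j hj0 hj
      rw [h7, h8]
      linarith [h2 i']
  -- line `k` is at most as high as that of action `i` at `γ`, and at least as high at `b (k + 1)`
  · obtain ⟨i', h7, h8⟩ := h.among k hk1 hkm
    have h9 := h1 i'
    rw [← h7, ← h8] at h9
    have h10 := h.le_line hkm (h4.trans h5.le) le_rfl i
    refine le_of_mul_le_mul_right (?_ : _ * (b (k + 1) - γ) ≤ _ * (b (k + 1) - γ)) (by linarith)
    linarith

theorem isOptimalLinear (h : A.HasEnvelope m r c b) (hA : A.SafetyFeasible) {γ β u : ℝ}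
    (hγ : γ ∈ Set.Icc (0 : ℝ) 1) (hβ : β ∈ Set.Icc (0 : ℝ) 1) {i : Fin n}
    (hI : A.Implements (linearContract γ β) i true)
    (hu : u = (1 - γ) * A.expectedReward i - β * A.inspectionCost)
    (hmax : ∀ k γ' β', EnvelopeContract A.safetyCost A.sideEffectProb m r c b k γ' β' →
      (1 - γ') * r k - β' * A.inspectionCost ≤ u) : A.IsOptimalLinear γ β := by
  refine ⟨hγ, hβ, i, true, hI, fun γ' hγ' β' hβ' i' s' hI' => ?_⟩
  cases s' with
  | false => exact bot_le
  | true =>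
    simp only [principalUtility, EReal.coe_le_coe_iff, expectedPayment_linearContract]
    have h1 : (1 - γ') * A.expectedReward i' - β' * A.inspectionCost ≤ u := by
      rcases (A.expectedReward_nonneg i').eq_or_lt with hR | hR
      -- an action without reward is implemented only if `κ_S = 0`, and then no inspection is
      -- needed at all
      · have h2 := (A.implements_linearContract_iff.1 hI').2.2
        have h3 := A.cost_nonneg i'
        have hS := A.safetyCost_nonneg
        rw [← hR] at h2 ⊢
        have hS0 : A.safetyCost = 0 := by linarith
        obtain ⟨l, hl⟩ := hA
        have hl0 := A.cost_nonneg l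
        obtain ⟨k, hk1, hkm, h4, h5⟩ := h.exists_line le_rfl (i := l) (by linarith) (by linarith)
        have h6 := hmax k 1 0 ⟨hk1, hkm, zero_le_one, le_rfl, le_rfl, zero_le_one, h4, h5.le,
          fun j hj => ?_⟩
        · have := mul_nonneg hβ'.1 A.inspectionCost_nonneg
          linarith
        · have h7 := h.env.le_line hj hkm h4 h5.le
          have h8 : 0 ≤ r j := h.env.slope_zero ▸ h.env.slope_mono (Nat.zero_le j) hj
          have h9 := mul_nonneg h8 A.sideEffectProb_pos.le
          rw [hS0]
          linarith
      · obtain ⟨k, h2, h3⟩ := h.exists_envelopeContract hγ' hβ' hR hI'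
        have h4 := mul_le_mul_of_nonneg_left h3 (sub_nonneg.2 hγ'.2)
        linarith [hmax k γ' β' h2]
    simp only [linearContract]
    linarith

end HasEnvelope

/-- Full pay and certain inspection implement a safe action, so the initial value of `sweep` is a
contract that may be returned. -/
theorem exists_implements_one_one (hA : A.SafetyFeasible) :
    ∃ i, A.Implements (linearContract 1 1) i true := by
  obtain ⟨l, hl⟩ := hA
  have : Nonempty (Fin n) := ⟨l⟩
  obtain ⟨i, hi⟩ := Finite.exists_max fun i => A.expectedReward i * 1 - A.cost i
  have h1 := hi l
  refine ⟨i, A.implements_linearContract_iff.2 ⟨hi, fun i' => ?_, by linarith⟩⟩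
  linarith [A.cost_nonneg i']

end SafetyAgent

/-! ### The program -/

open RealRAM in
/-- Sort the actions, compute the envelope, and sweep over it. -/
def optimalContractProgram : Program := .block [sort, buildEnvelope, sweep]

open RealRAM in
theorem halts_optimalContractProgram {n : ℕ} {A : SafetyAgent n} (hA : A.NoDominatedAction)
    (hS : A.SafetyFeasible) :
    Halts optimalContractProgram A.inputStore (3 * ((Nat.log 2 (2 * n) + 1) * (n + 1)))
      (fun σ => A.IsOptimalLinear (σ.real 3 0) (σ.real 3 1)) := by
  have hn : 1 ≤ n := by
    obtain ⟨i, -⟩ := hS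
    exact i.pos
  have hW : n + 1 ≤ (Nat.log 2 (2 * n) + 1) * (n + 1) := Nat.le_mul_of_pos_left _ (by omega)
  set R := A.inputStore.real 0 with hR
  set C := A.inputStore.real 1 with hC
  set p := A.inputStore.real 2 with hp
  have hRi : ∀ i : Fin n, R i = A.expectedReward i := fun i => by
    simp [hR, SafetyAgent.inputStore]
  have hCi : ∀ i : Fin n, C i = A.cost i := fun i => by
    simp [hC, SafetyAgent.inputStore]
  have hR0 : ∀ l < n, 0 ≤ R l := fun l hl => hRi ⟨l, hl⟩ ▸ A.expectedReward_nonneg _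
  have hC0 : ∀ l < n, 0 ≤ C l := fun l hl => hCi ⟨l, hl⟩ ▸ A.cost_nonneg _
  have hinj : ∀ l < n, ∀ l' < n, C l = C l' → l = l' := fun l hl l' hl' h => by
    have := @hA.1 ⟨l, hl⟩ ⟨l', hl'⟩ (by rw [← hCi, ← hCi]; exact h)
    exact congrArg Fin.val this
  have hRC : ∀ l < n, ∀ l' < n, C l < C l' → R l < R l' := fun l hl l' hl' h => by
    have := hA.2 ⟨l, hl⟩ ⟨l', hl'⟩ (by rw [← hCi, ← hCi]; exact h)
    rwa [← hRi, ← hRi] at this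
  refine Halts.seq (by positivity) ((halts_sort (n := n) (R := R) (p := p)
    ⟨by simp [SafetyAgent.inputStore], rfl, rfl⟩ hC.symm hn hC0 hinj).mono (by omega)
    fun _ h => h) ?_
  rintro σ ⟨hk, hs⟩
  refine Halts.seq (by positivity) ((halts_buildEnvelope hk rfl rfl ?_ ?_ ?_).mono (by omega)
    fun _ h => h) ?_
  · intro l hl
    obtain ⟨l', hl', h1, -⟩ := hs.origin l hl
    exact h1 ▸ hR0 l' hl'
  · intro l hl
    obtain ⟨l', hl', -, h1⟩ := hs.origin l hl
    exact h1 ▸ hC0 l' hl'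
  · intro l l' hll hl'
    obtain ⟨k, hk, h1, h2⟩ := hs.origin l (by omega)
    obtain ⟨k', hk', h3, h4⟩ := hs.origin l' hl'
    have := hs.mono l l' hll hl'
    rw [h1, h3]
    rw [h2, h4] at this
    exact hRC k hk k' hk' this
  rintro τ ⟨hk', hm, henv, hlast, hamong, hcover⟩
  have hE : A.HasEnvelope (τ.nat 4 0) (τ.real 7) (τ.real 8) (τ.real 9) := by
    refine ⟨henv, hlast, fun k h1 h2 => ?_, fun i x => ?_⟩
    · obtain ⟨l, hl, h3, h4⟩ := hamong k h1 h2
      obtain ⟨l', hl', h5, h6⟩ := hs.origin l hl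
      exact ⟨⟨l', hl'⟩, by rw [h3, h5, ← hRi], by rw [h4, h6, ← hCi]⟩
    · obtain ⟨l, hl, h3, h4⟩ := hs.mem i i.2
      obtain ⟨k, hk, h5⟩ := hcover l hl x
      rw [h3, h4, hRi, hCi] at h5
      exact ⟨k, hk, h5⟩
  refine (halts_sweep (G := fun γ β u => γ ∈ Set.Icc (0 : ℝ) 1 ∧ β ∈ Set.Icc (0 : ℝ) 1 ∧
    ∃ i, A.Implements (linearContract γ β) i true ∧
      u = (1 - γ) * A.expectedReward i - β * A.inspectionCost) hk' rfl rfl rfl rfl henv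
    A.safetyCost_nonneg A.inspectionCost_nonneg A.sideEffectProb_pos A.sideEffectProb_le_one
    ?_ ?_).mono (by omega) ?_
  · obtain ⟨i, hi⟩ := SafetyAgent.exists_implements_one_one hS
    refine ⟨by simp, by simp, i, hi, ?_⟩
    simp [hp, SafetyAgent.inputStore]
  · intro k γ β h1
    obtain ⟨i, h2, h3⟩ := hE.implements h1
    exact ⟨⟨h1.share_nonneg, h1.share_le_one⟩, ⟨h1.inspection_nonneg, h1.inspection_le_one⟩, i, h3,
      by rw [h2]; rfl⟩
  · rintro υ ⟨u, ⟨h1, h2, i, h3, h4⟩, h5⟩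
    exact hE.isOptimalLinear hS h1 h2 h3 h4 h5

theorem isBigO_workload : (fun n : ℕ => (((Nat.log 2 (2 * n) + 1) * (n + 1) : ℕ) : ℝ)) =O[atTop]
    (fun n : ℕ => (n : ℝ) * Real.log (n : ℝ)) := by
  have hlog : 0 < Real.log 2 := Real.log_pos one_lt_two
  refine IsBigO.of_bound (6 / Real.log 2) ?_
  filter_upwards [eventually_ge_atTop 2] with n hn
  have hn' : (2 : ℝ) ≤ n := by exact_mod_cast hn
  have h1 : Real.log 2 ≤ Real.log n := Real.log_le_log two_pos hn'
  have h2 : (Nat.log 2 n : ℝ) * Real.log 2 ≤ Real.log n := by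
    have := Real.natLog_le_logb n 2
    rwa [Real.logb, Nat.cast_ofNat, le_div_iff₀ hlog] at this
  rw [mul_comm 2 n, Nat.log_mul_base one_lt_two (by omega), Real.norm_of_nonneg (by positivity),
    Real.norm_of_nonneg (mul_nonneg (by linarith) (by linarith)), div_mul_eq_mul_div,
    le_div_iff₀ hlog]
  push_cast
  calc ((Nat.log 2 n : ℝ) + 1 + 1) * (n + 1) * Real.log 2
      = ((Nat.log 2 n : ℝ) * Real.log 2 + 2 * Real.log 2) * (n + 1) := by ring
    _ ≤ (3 * Real.log n) * (2 * n) := by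
        refine mul_le_mul (by linarith) (by linarith) (by positivity) (by linarith)
    _ = 6 * (n * Real.log n) := by ring

theorem mainTheorem2 :
    ∃ (P : RealRAM.Program) (T : ℕ → ℕ),
      (fun n : ℕ => (T n : ℝ)) =O[atTop] (fun n : ℕ => (n : ℝ) * Real.log (n : ℝ)) ∧
      ∀ (n : ℕ) (A : SafetyAgent n), A.NoDominatedAction → A.SafetyFeasible →
        ∃ (σ : RealRAM.Store) (t : ℕ),
          RealRAM.Runs P A.inputStore σ t ∧ t ≤ T n ∧
            A.IsOptimalLinear (σ.real 3 0) (σ.real 3 1) := by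
  refine ⟨optimalContractProgram, fun n => optimalContractProgram.size *
    (3 * ((Nat.log 2 (2 * n) + 1) * (n + 1))), ?_, fun n A hA hS =>
      halts_optimalContractProgram hA hS⟩
  have := isBigO_workload.const_mul_left ((optimalContractProgram.size * 3 : ℕ) : ℝ)
  refine this.congr_left fun n => ?_
  push_cast
  ring
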